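/- Let $G=(V,E)$ be a finite directed network with a source $s$ and a destination $d$, and let $\mathcal P$ be the set of loop-free paths from $s$ to $d$, each path identified with its set of links. Let $H=\max_{p\in\mathcal P}|p|$. Every transmission attempt on link $i$ succeeds independently with unknown probability $\theta_i\in(0,1]$ and is repeated until it succeeds, so that the delays of the successive packets on link $i$ are i.i.d. geometric with mean $1/\theta_i$, independently over the links. Put $\theta_{\min}=\min_i\theta_i$, $D_\theta(p)=\sum_{i\in p}1/\theta_i$, $D^\star=\min_{p\in\mathcal P}D_\theta(p)$, $\Delta_p=D_\theta(p)-D^\star$, and assume that some path is suboptimal, so that $\Delta_{\min}=\min_{p:\Delta_p\neq0}\Delta_p$ is defined. Packets $n=1,2,\dots$ are sent successively; the path $p(n)$ of packet $n$ is chosen at the source from the per-link delays observed for the previous packets, possibly with randomization. The regret is $R^\pi(N)=\mathbb E\big[\sum_{n=1}^N D^\pi(n)\big]-N D^\star$, where $D^\pi(n)$ is the end-to-end delay of packet $n$. Let $s_i(n)$ be the number of packets routed through link $i$ and $t_i(n)$ the number of transmission attempts on link $i$ before packet $n$ is sent, $\hat\theta_i(n)=s_i(n)/t_i(n)$ if $t_i(n)>0$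 and $\hat\theta_i(n)=0$ otherwise, $\mathrm{KL}(x,y)$ the Kullback--Leibler divergence between Bernoulli laws with means $x$ and $y$, and $f_1(n)=\log n+4H\log\log n$. For $p\in\mathcal P$ let $$b_p(n)=\inf\Big\{\sum_{i\in p}\frac1{u_i}:\ u\in(0,1]^{E},\ \sum_{i\in p}t_i(n)\,\mathrm{KL}(\hat\theta_i(n),u_i)\le f_1(n)\Big\},$$ $$c_p(n)=\sum_{i\in p}\frac1{\hat\theta_i(n)}-\sqrt{\frac{f_1(n)}2\sum_{i\in p}\frac1{s_i(n)\hat\theta_i(n)^3}},$$ with $c_p(n)=-\infty$ if $s_i(n)=0$ for some $i\in p$. GeoCombUCB-1 and GeoCombUCB-2 choose, for each $n\ge3$, a path $p(n)\in\arg\min_{p\in\mathcal P}\xi_p(n)$ with $\xi=b$ and $\xi=c$ respectively, ties being broken arbitrarily; the paths of the first two packets (where $f_1(n)$ is undefined or negative) are arbitrary. **Theorem.** There is a constant $K'_H\ge0$ depending only on $H$ such that, for $\pi\in\{\text{GeoCombUCB-1},\text{GeoCombUCB-2}\}$, for every $\epsilon$ with $0<\epsilon<\min(1,\Delta_{\min}/D^\star)$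 and every $N\ge3$, $$R^\pi(N)\le\frac{4M(\theta,\epsilon)\,|E|\sqrt H\,\big(\log N+4H\log\log N\big)}{\Delta_{\min}\theta_{\min}^3}+H\theta_{\min}^{-1}\Big(K'_H+2\epsilon^{-2}\sum_{i\in E}\theta_i^{-2}\Big),\qquad M(\theta,\epsilon)=\frac{(1+\epsilon)^2}{(1-\epsilon)^3(1-\epsilon D^\star/\Delta_{\min})^2}.$$ Hence $R^\pi(N)=O(|E|\sqrt H\log N)$ as $N\to\infty$; precisely, there is an absolute constant $C>0$ such that $|R^\pi(N)|\le \dfrac{C}{\Delta_{\min}\theta_{\min}^3}\,|E|\sqrt H\log N$ for all large enough $N$ (how large may depend on the network, $\theta$ and the policy). -/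

import Mathlib

open MeasureTheory ProbabilityTheory

noncomputable section

namespace ShortestPath

/-- A directed network with nodes `V`, links `E` (parallel links are allowed) and a
source-destination pair `(s, d)`. -/
structure Network (V E : Type*) where
  src : E → V
  tgt : E → V
  s : V
  d : V

namespace Network

variable {V E : Type*}

/-- `G.IsWalk u l v`: the list of links `l` is a directed walk from node `u` to node `v`. -/
def IsWalk (G : Network V E) : V → List E → V → Prop
  | u, [], v => u = v
  | u, e :: l, v => G.src e = u ∧ G.IsWalk (G.tgt e) l v

/-- `p` is the set of links of a loop-free path (no node is visited twice) from `s` to `d`. -/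
def IsPath (G : Network V E) (p : Finset E) : Prop :=
  ∃ l : List E, G.IsWalk G.s l G.d ∧ (G.s :: l.map G.tgt).Nodup ∧ ∀ e, e ∈ p ↔ e ∈ l

variable [Fintype E]

open Classical in
/-- The set `𝒫` of loop-free paths from `s` to `d`; the binary vector of a path is represented by
the set of links it uses. -/
def paths (G : Network V E) : Finset (Finset E) :=
  Finset.univ.filter G.IsPath

/-- `H`, the maximal length of a path. -/
def maxLength (G : Network V E) : ℕ := G.paths.sup Finset.card

/-- `D_θ(p) = ∑_{i ∈ p} 1 / θ_i`, the average delay of a path. -/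
def pathDelay (θ : E → ℝ) (p : Finset E) : ℝ := ∑ i ∈ p, (θ i)⁻¹

/-- `D⋆`, the minimal average delay of a path. -/
def optDelay (G : Network V E) (θ : E → ℝ) : ℝ :=
  sInf {x | ∃ p ∈ G.paths, x = pathDelay θ p}

/-- `Δ_p = D_θ(p) - D⋆`. -/
def gap (G : Network V E) (θ : E → ℝ) (p : Finset E) : ℝ := pathDelay θ p - G.optDelay θ

/-- `Δ_min`, the smallest non-zero gap of a path (used only when there is one). -/
def gapMin (G : Network V E) (θ : E → ℝ) : ℝ :=
  sInf {x | ∃ p ∈ G.paths, G.gap θ p ≠ 0 ∧ x = G.gap θ p}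

/-- `θ_min`, the smallest success probability of a link. -/
def thetaMin (θ : E → ℝ) : ℝ := ⨅ i, θ i

end Network

/-- `KL(x, y)`, the Kullback-Leibler divergence of two Bernoulli distributions with means
`x, y ∈ [0, 1]`. -/
def bernoulliKL (x y : ℝ) : ENNReal :=
  open Classical in
  if (y = 0 ∧ x ≠ 0) ∨ (y = 1 ∧ x ≠ 1) then ⊤
  else ENNReal.ofReal (x * Real.log (x / y) + (1 - x) * Real.log ((1 - x) / (1 - y)))

/-- `f₁(n) = log n + 4 H log log n`. -/
def f₁ (H n : ℕ) : ℝ := Real.log n + 4 * H * Real.log (Real.log n)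

/-- The path index `b_p(n)`, for the numbers `t_i` of transmission attempts and the empirical
success probabilities `lam_i`. The infimum of the empty set is `+∞`. -/
def bIndex {E : Type*} (H n : ℕ) (t : E → ℕ) (lam : E → ℝ) (p : Finset E) : EReal :=
  ⨅ u ∈ {u : E → ℝ | (∀ i, 0 < u i ∧ u i ≤ 1) ∧
      ((∑ i ∈ p, (t i : ENNReal) * bernoulliKL (lam i) (u i) : ENNReal) : EReal) ≤ (f₁ H n : ℝ)},
    ((∑ i ∈ p, (u i)⁻¹ : ℝ) : EReal)

/-- The path index `c_p(n)`, for the numbers `s_i` of packets routed and the empirical success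
probabilities `lam_i`. On a path with a link that no packet has used, the formula reads `∞ - ∞`;
its value is taken to be the limit `-∞` as `s_i → 0` with `lam_i = s_i / t_i`. -/
def cIndex {E : Type*} (H n : ℕ) (s : E → ℕ) (lam : E → ℝ) (p : Finset E) : EReal :=
  open Classical in
  if ∃ i ∈ p, s i = 0 then ⊥
  else ((∑ i ∈ p, (lam i)⁻¹ -
    Real.sqrt (f₁ H n / 2 * ∑ i ∈ p, 1 / ((s i : ℝ) * lam i ^ 3)) : ℝ) : EReal)

/-- Source routing of packets `1, 2, 3, …` over the network `G` whose link `i` has success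
probability `θ i`, on a probability space `(Ω, μ)`. `delay n i` is the delay of packet `n` on link
`i` if it uses that link, i.e. the number of independent transmission attempts, each successful with
probability `θ i`, up to the first success; it is observed only if `i ∈ path n`.
`past n` is the information available after packet `n`; it contains the delays of the packets
`1, …, n` and possibly some randomization of the policy or of the breaking of ties. The path of a
packet is chosen from the past. -/
structure RoutingProcess {V E : Type*} [Fintype E] (G : Network V E) (θ : E → ℝ)
    {Ω : Type*} [MeasurableSpace Ω] (μ : Measure Ω) where
  past : Filtration ℕ (inferInstance : MeasurableSpace Ω)
  delay : ℕ → E → Ω → ℕ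
  path : ℕ → Ω → Finset E
  path_mem : ∀ n ω, path n ω ∈ G.paths
  path_past : ∀ n q, MeasurableSet[past n] {ω | path (n + 1) ω = q}
  delay_past : ∀ n i, Measurable[past (n + 1)] (delay (n + 1) i)
  delay_law : ∀ n i k, μ {ω | delay (n + 1) i ω = k + 1} = ENNReal.ofReal ((1 - θ i) ^ k * θ i)
  delay_indep_links : ∀ n, iIndepFun (fun i => delay (n + 1) i) μ
  delay_indep_past : ∀ n,
    Indep (MeasurableSpace.comap (fun ω i => delay (n + 1) i ω) inferInstance) (past n) μ

namespace RoutingProcess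

variable {V E : Type*} [Fintype E] {G : Network V E} {θ : E → ℝ}
  {Ω : Type*} [MeasurableSpace Ω] {μ : Measure Ω}

open Classical in
/-- `s_i(n)`, the number of packets routed through link `i` before packet `n` is sent. -/
def packets (R : RoutingProcess G θ μ) (n : ℕ) (ω : Ω) (i : E) : ℕ :=
  ∑ k ∈ Finset.Ico 1 n, if i ∈ R.path k ω then 1 else 0

open Classical in
/-- `t_i(n)`, the number of transmission attempts on link `i` before packet `n` is sent. -/
def attempts (R : RoutingProcess G θ μ) (n : ℕ) (ω : Ω) (i : E) : ℕ :=
  ∑ k ∈ Finset.Ico 1 n, if i ∈ R.path k ω then R.delay k i ω else 0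

/-- The empirical success probability: `s_i(n) / t_i(n)` if `t_i(n) > 0`, and `0` otherwise. -/
def empirical (R : RoutingProcess G θ μ) (n : ℕ) (ω : Ω) (i : E) : ℝ :=
  if 0 < R.attempts n ω i then (R.packets n ω i : ℝ) / (R.attempts n ω i : ℝ) else 0

/-- The index `b_p(n)` in the run `ω`. -/
def b (R : RoutingProcess G θ μ) (n : ℕ) (ω : Ω) (p : Finset E) : EReal :=
  bIndex G.maxLength n (R.attempts n ω) (R.empirical n ω) p

/-- The index `c_p(n)` in the run `ω`. -/
def c (R : RoutingProcess G θ μ) (n : ℕ) (ω : Ω) (p : Finset E) : EReal :=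
  cIndex G.maxLength n (R.packets n ω) (R.empirical n ω) p

/-- The run follows GeoCombUCB-1: `path n` minimizes `b_p(n)`, ties being broken arbitrarily.
The paths of packets `1` and `2` are arbitrary: `f₁(1)` is undefined and `f₁(2) < 0`. -/
def IsGeoCombUCB1 (R : RoutingProcess G θ μ) : Prop :=
  ∀ n, 3 ≤ n → ∀ᵐ ω ∂μ, ∀ q ∈ G.paths, R.b n ω (R.path n ω) ≤ R.b n ω q

/-- The run follows GeoCombUCB-2: `path n` minimizes `c_p(n)`, ties being broken arbitrarily.
The paths of packets `1` and `2` are arbitrary: `f₁(1)` is undefined and `f₁(2) < 0`. -/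
def IsGeoCombUCB2 (R : RoutingProcess G θ μ) : Prop :=
  ∀ n, 3 ≤ n → ∀ᵐ ω ∂μ, ∀ q ∈ G.paths, R.c n ω (R.path n ω) ≤ R.c n ω q

/-- `D^π(n)`, the end-to-end delay of packet `n`. -/
def totalDelay (R : RoutingProcess G θ μ) (n : ℕ) (ω : Ω) : ℝ :=
  ∑ i ∈ R.path n ω, (R.delay n i ω : ℝ)

/-- The regret `R^π(N) = 𝔼[∑_{n=1}^N D^π(n)] - N D⋆`. -/
def regret (R : RoutingProcess G θ μ) (N : ℕ) : ℝ :=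
  (∫ ω, ∑ n ∈ Finset.Icc 1 N, R.totalDelay n ω ∂μ) - N * G.optDelay θ

end RoutingProcess

/-- `M(θ, ε) = (1 + ε)² / ((1 - ε)³ (1 - ε D⋆ / Δ_min)²)`. -/
def M {V E : Type*} [Fintype E] (G : Network V E) (θ : E → ℝ) (ε : ℝ) : ℝ :=
  (1 + ε) ^ 2 / ((1 - ε) ^ 3 * (1 - ε * G.optDelay θ / G.gapMin θ) ^ 2)

end ShortestPath

end

/-!
The regret is the expected sum of the gaps of the chosen paths, because the path of a packet is
independent of the delays that it meets. Fix an optimal path. Whenever the true parameter `θ`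
satisfies the likelihood constraint of the index `b` on that path, its index is at most `D⋆`, hence
so is the index of the chosen path; as `c ≤ b` (`cIndex_le_bIndex`: Pinsker's inequality and
Cauchy-Schwarz), the chosen path `p` has `c_p(n) ≤ D⋆` under both policies. If moreover the
estimates on `p` have relative accuracy `ε`, then `Δ_p ^ 2 ≤ Φ ∑_{i ∈ p} 1 / s_i(n)` with `Φ`
proportional to `f₁(N)` (`sq_le_of_cIndex_le`), and a counting argument (`sum_le_of_sq_le_sum_inv`)
bounds the sum of the gaps over all such rounds by `8 Φ |E| √H / Δ_min`. The other rounds are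
exceptional, and each costs at most `H / θ_min`.

Exceptional rounds are controlled by likelihood ratios of geometric delays, whose products along
predictable sets of links have expectation at most one (`lintegral_prod_le_one`).

* For a single link and a given number of uses, one alternative parameter on each side of `θ i`
  gives the exponential bound of `exists_accurate_event`. A link has each count at most once, so the
  expected number of rounds with an inaccurate estimate is a geometric sum.
* For the constraint of the index `b`, the divergence `∑ t_i KL(θ̂_i, θ_i)` is the logarithm of a
  likelihood ratio maximized over the alternatives. On each link the maximum is attained up to a
  factor `e` on a grid of `O(log² n)` alternatives (`exists_likRatio_grid`), so that a union bound
  over the grids loses a factor `O(log n) ^ (2 H)` only. The term `4 H log log n` of `f₁` more than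
  compensates for it, and the probabilities `O(1 / (n log² n))` are summable
  (`exists_feasible_event`, `feasible_bound_le`).
-/

namespace ShortestPath

/-! ### The Bernoulli divergence -/

/-- The Bernoulli Kullback-Leibler divergence as a real number. The value at `y = 1` is junk unless
`x = 1`. -/
noncomputable def klReal (x y : ℝ) : ℝ :=
  x * Real.log (x / y) + (1 - x) * Real.log ((1 - x) / (1 - y))

lemma klReal_self (x : ℝ) : klReal x x = 0 := by
  unfold klReal
  rcases eq_or_ne x 0 with rfl | hx
  · simp
  rcases eq_or_ne (1 - x) 0 with h1 | h1
  · simp [h1, div_self hx]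
  · simp [div_self hx, div_self h1]

/-- Pinsker's inequality for Bernoulli laws. -/
theorem two_mul_sq_le_klReal {x y : ℝ} (hx : 0 < x) (hx1 : x ≤ 1) (hy : 0 < y) (hy1 : y < 1) :
    2 * (x - y) ^ 2 ≤ klReal x y := by
  -- The difference of the two sides is, up to a constant, the function `F` of `y`, which decreases
  -- up to `x` and increases from there on.
  set F : ℝ → ℝ := fun z => -(x * Real.log z) - (1 - x) * Real.log (1 - z) - 2 * (x - z) ^ 2 with hF
  have hder : ∀ z : ℝ, 0 < z → z < 1 →
      HasDerivAt F ((z - x) * (1 / (z * (1 - z)) - 4)) z := by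
    intro z hz hz1
    have h1 : HasDerivAt (fun z : ℝ => Real.log (1 - z)) (-1 / (1 - z)) z := by
      have := ((hasDerivAt_id z).const_sub 1).log (by simp; linarith)
      simpa using this
    have h2 := ((Real.hasDerivAt_log hz.ne').const_mul x).neg
    have h3 := (((hasDerivAt_id z).const_sub x).pow 2).const_mul 2
    have h4 := (h2.sub (h1.const_mul (1 - x))).sub h3
    refine h4.congr_deriv ?_
    have hz' : (1 - z) ≠ 0 := by linarith
    simp
    field_simp
    ring
  have hcont : ∀ z : ℝ, 0 < z → z ≤ x → ContinuousAt F z := by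
    intro z hz hzx
    rcases eq_or_lt_of_le hx1 with rfl | hx1
    · simp only [hF, sub_self, zero_mul]
      have := Real.continuousAt_log hz.ne'
      fun_prop
    · exact (hder z hz (by linarith)).continuousAt
  have hpos : ∀ z : ℝ, 0 < z → z < 1 → 0 ≤ 1 / (z * (1 - z)) - 4 := by
    intro z hz hz1
    rw [sub_nonneg, le_div_iff₀ (by nlinarith)]
    nlinarith [sq_nonneg (2 * z - 1)]
  have key : F x ≤ F y := by
    rcases le_total y x with hyx | hxy
    · refine antitoneOn_of_deriv_nonpos (convex_Icc y x) ?_ ?_ ?_ (Set.left_mem_Icc.2 hyx)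
        (Set.right_mem_Icc.2 hyx) hyx
      · intro z hz
        exact (hcont z (by linarith [hz.1]) hz.2).continuousWithinAt
      · intro z hz
        rw [interior_Icc] at hz
        exact (hder z (by linarith [hz.1])
          (by linarith [hz.2])).differentiableAt.differentiableWithinAt
      · intro z hz
        rw [interior_Icc] at hz
        have h0 : 0 < z := by linarith [hz.1]
        have h1 : z < 1 := by linarith [hz.2]
        rw [(hder z h0 h1).deriv]
        exact mul_nonpos_of_nonpos_of_nonneg (by linarith [hz.2]) (hpos z h0 h1)
    · refine monotoneOn_of_deriv_nonneg (convex_Icc x y) ?_ ?_ ?_ (Set.left_mem_Icc.2 hxy)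
        (Set.right_mem_Icc.2 hxy) hxy
      · intro z hz
        exact (hder z (by linarith [hz.1]) (by linarith [hz.2])).continuousAt.continuousWithinAt
      · intro z hz
        rw [interior_Icc] at hz
        exact (hder z (by linarith [hz.1])
          (by linarith [hz.2])).differentiableAt.differentiableWithinAt
      · intro z hz
        rw [interior_Icc] at hz
        have h0 : 0 < z := by linarith [hz.1]
        have h1 : z < 1 := by linarith [hz.2]
        rw [(hder z h0 h1).deriv]
        exact mul_nonneg (by linarith [hz.1]) (hpos z h0 h1)
  have e1 : x * Real.log (x / y) = x * Real.log x - x * Real.log y := by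
    rw [Real.log_div hx.ne' hy.ne']; ring
  have e2 : (1 - x) * Real.log ((1 - x) / (1 - y))
      = (1 - x) * Real.log (1 - x) - (1 - x) * Real.log (1 - y) := by
    rcases eq_or_ne (1 - x) 0 with h | h
    · simp [h]
    · rw [Real.log_div h (by linarith)]; ring
  simp only [hF] at key
  rw [klReal, e1, e2]
  linarith [key]

lemma klReal_nonneg {x y : ℝ} (hx : 0 < x) (hx1 : x ≤ 1) (hy : 0 < y) (hy1 : y < 1) :
    0 ≤ klReal x y :=
  le_trans (by positivity) (two_mul_sq_le_klReal hx hx1 hy hy1)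

lemma bernoulliKL_eq_ofReal {x y : ℝ} (hy : 0 < y) (hy1 : y < 1) :
    bernoulliKL x y = ENNReal.ofReal (klReal x y) := by
  unfold bernoulliKL klReal
  rw [if_neg]
  rintro (⟨h, -⟩ | ⟨h, -⟩) <;> linarith

lemma bernoulliKL_one_one : bernoulliKL 1 1 = 0 := by
  simp [bernoulliKL]

/-! ### Likelihood ratios of geometric laws -/

/-- The likelihood ratio of success probability `u` against `θ` for `s` successes in `t` trials. -/
noncomputable def likRatio (θ u : ℝ) (s t : ℕ) : ℝ := (u / θ) ^ s * ((1 - u) / (1 - θ)) ^ (t - s)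

/-- The divergence per success, `KL(x, θ) / x`. -/
noncomputable def klRate (θ x : ℝ) : ℝ :=
  Real.log (x / θ) + (x⁻¹ - 1) * Real.log ((1 - x) / (1 - θ))

lemma mul_klRate {θ x : ℝ} (hx : x ≠ 0) : x * klRate θ x = klReal x θ := by
  unfold klRate klReal; field_simp

lemma klRate_self {θ : ℝ} (hθ : 0 < θ) : klRate θ θ = 0 := by
  have := mul_klRate (θ := θ) hθ.ne'
  rw [klReal_self] at this
  simpa [hθ.ne'] using this

lemma continuousOn_klRate {θ : ℝ} (hθ : 0 < θ) (hθ1 : θ < 1) :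
    ContinuousOn (klRate θ) (Set.Ioc 0 1) := by
  have e : Set.EqOn (klRate θ) (fun x => Real.log (x / θ) + x⁻¹ * ((1 - x) * Real.log (1 - x))
      - (x⁻¹ - 1) * Real.log (1 - θ)) (Set.Ioc 0 1) := by
    intro x hx
    have hx0 : x ≠ 0 := hx.1.ne'
    simp only [klRate]
    rcases eq_or_lt_of_le hx.2 with rfl | h1
    · simp
    · rw [Real.log_div (by linarith : (1 - x) ≠ 0) (by linarith)]
      field_simp
      ring
  refine ContinuousOn.congr ?_ e
  have hc : Continuous fun x : ℝ => (1 - x) * Real.log (1 - x) :=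
    Real.continuous_mul_log.comp (continuous_const.sub continuous_id)
  have hi : ContinuousOn (fun x : ℝ => x⁻¹) (Set.Ioc 0 1) :=
    continuousOn_inv₀.mono fun x hx => hx.1.ne'
  have hl : ContinuousOn (fun x : ℝ => Real.log (x / θ)) (Set.Ioc 0 1) :=
    ContinuousOn.log (by fun_prop) fun x hx => (div_pos hx.1 hθ).ne'
  exact (hl.add (hi.mul hc.continuousOn)).sub ((hi.sub continuousOn_const).mul continuousOn_const)

/-- The log-likelihood ratio of `u` at the empirical mean `x`, per success; its maximum over `u` is
`klRate θ x`, attained only at `u = x`. -/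
lemma lt_klRate {θ x u : ℝ} (hθ : 0 < θ) (hθ1 : θ < 1) (hx : 0 < x) (hx1 : x ≤ 1) (hu : 0 < u)
    (hu1 : u < 1) (hne : x ≠ u) :
    Real.log (u / θ) + (x⁻¹ - 1) * Real.log ((1 - u) / (1 - θ)) < klRate θ x := by
  have hk : 0 < klReal x u :=
    lt_of_lt_of_le (by have := sub_ne_zero.2 hne; positivity) (two_mul_sq_le_klReal hx hx1 hu hu1)
  have e : klRate θ x - (Real.log (u / θ) + (x⁻¹ - 1) * Real.log ((1 - u) / (1 - θ)))
      = x⁻¹ * klReal x u := by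
    unfold klRate klReal
    rw [Real.log_div hx.ne' hθ.ne', Real.log_div hu.ne' hθ.ne', Real.log_div hx.ne' hu.ne',
      Real.log_div (by linarith : 1 - u ≠ 0) (by linarith)]
    rcases eq_or_lt_of_le hx1 with rfl | h1
    · simp; ring
    · rw [Real.log_div (by linarith : 1 - x ≠ 0) (by linarith),
        Real.log_div (by linarith : 1 - x ≠ 0) (by linarith)]
      field_simp
      ring
  have : 0 < x⁻¹ * klReal x u := by positivity
  linarith

/-- Below `θ`, the divergence per success is strictly decreasing. -/
lemma klRate_lt_of_lt_of_le {θ u x : ℝ} (hθ1 : θ < 1) (hu : 0 < u) (hux : u < x)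
    (hxθ : x ≤ θ) : klRate θ x < klRate θ u := by
  have hx : 0 < x := hu.trans hux
  have hθ : 0 < θ := hx.trans_le hxθ
  refine lt_of_le_of_lt ?_ (lt_klRate (u := x) hθ hθ1 hu (by linarith) hx (by linarith) hux.ne)
  have hl : 0 ≤ Real.log ((1 - x) / (1 - θ)) :=
    Real.log_nonneg (by rw [le_div_iff₀ (by linarith)]; linarith)
  have hi : x⁻¹ ≤ u⁻¹ := by gcongr
  unfold klRate
  gcongr

/-- Above `θ`, the divergence per success is strictly increasing. -/
lemma klRate_lt_of_le_of_lt {θ x u : ℝ} (hθ : 0 < θ) (hθx : θ ≤ x) (hxu : x < u)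
    (hu1 : u ≤ 1) : klRate θ x < klRate θ u := by
  have hx : 0 < x := hθ.trans_le hθx
  refine lt_of_le_of_lt ?_ (lt_klRate (u := x) hθ (by linarith) (hx.trans hxu) hu1 hx (by linarith)
    hxu.ne')
  have hl : Real.log ((1 - x) / (1 - θ)) ≤ 0 :=
    Real.log_nonpos (div_nonneg (by linarith) (by linarith))
      (by rw [div_le_one (by linarith)]; linarith)
  have hi : u⁻¹ ≤ x⁻¹ := by gcongr
  unfold klRate
  have := mul_le_mul_of_nonpos_right (sub_le_sub_right hi 1) hl
  linarith

lemma likRatio_eq_exp {θ u : ℝ} {s t : ℕ} (hθ : 0 < θ) (hθ1 : θ < 1) (hu : 0 < u) (hu1 : u < 1)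
    (hst : s ≤ t) :
    likRatio θ u s t
      = Real.exp (s * Real.log (u / θ) + (t - s) * Real.log ((1 - u) / (1 - θ))) := by
  have h1 : 0 < u / θ := div_pos hu hθ
  have h2 : 0 < (1 - u) / (1 - θ) := div_pos (by linarith) (by linarith)
  rw [Real.exp_add, likRatio, ← Nat.cast_sub hst, mul_comm (s : ℝ), mul_comm ((t - s : ℕ) : ℝ),
    Real.exp_mul, Real.exp_mul, Real.exp_log h1, Real.exp_log h2, Real.rpow_natCast,
    Real.rpow_natCast]

/-- The likelihood ratio of a parameter `u ≤ θ` is at least `exp (s * klRate θ u)` when the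
empirical mean `s / t` is at most `u`. -/
lemma exp_mul_klRate_le_likRatio_of_le {θ u : ℝ} {s t : ℕ} (hθ1 : θ < 1) (hu : 0 < u)
    (huθ : u ≤ θ) (hst : s ≤ t) (ht : (s : ℝ) / u ≤ t) :
    Real.exp (s * klRate θ u) ≤ likRatio θ u s t := by
  have hθ : 0 < θ := hu.trans_le huθ
  rw [likRatio_eq_exp hθ hθ1 hu (by linarith) hst, Real.exp_le_exp]
  have hl : 0 ≤ Real.log ((1 - u) / (1 - θ)) :=
    Real.log_nonneg (by rw [le_div_iff₀ (by linarith)]; linarith)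
  have e : (s : ℝ) * klRate θ u
      = s * Real.log (u / θ) + (s / u - s) * Real.log ((1 - u) / (1 - θ)) := by
    unfold klRate; ring
  rw [e]
  gcongr

/-- The likelihood ratio of a parameter `u ≥ θ` is at least `exp (s * klRate θ u)` when the
empirical mean `s / t` is at least `u`. -/
lemma exp_mul_klRate_le_likRatio_of_ge {θ u : ℝ} {s t : ℕ} (hθ : 0 < θ) (hθ1 : θ < 1)
    (huθ : θ ≤ u) (hu1 : u ≤ 1) (hst : s ≤ t) (ht : (t : ℝ) ≤ s / u) :
    Real.exp (s * klRate θ u) ≤ likRatio θ u s t := by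
  have hu : 0 < u := hθ.trans_le huθ
  rcases eq_or_lt_of_le hu1 with rfl | hu1
  · -- all the trials are successes
    obtain rfl : s = t := le_antisymm hst (by simpa using ht)
    have h1 : 0 < 1 / θ := by positivity
    simp only [klRate, likRatio]
    rw [Nat.sub_self, pow_zero, mul_one, mul_comm, Real.exp_mul]
    simp only [inv_one, sub_self, zero_mul, add_zero]
    rw [Real.exp_log h1, Real.rpow_natCast]
  rw [likRatio_eq_exp hθ hθ1 hu hu1 hst, Real.exp_le_exp]
  have hl : Real.log ((1 - u) / (1 - θ)) ≤ 0 :=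
    Real.log_nonpos (div_nonneg (by linarith) (by linarith))
      (by rw [div_le_one (by linarith)]; linarith)
  have e : (s : ℝ) * klRate θ u
      = s * Real.log (u / θ) + (s / u - s) * Real.log ((1 - u) / (1 - θ)) := by
    unfold klRate; ring
  rw [e]
  have := mul_le_mul_of_nonpos_right (sub_le_sub_right ht (s : ℝ)) hl
  linarith

/-- For every level `v`, a single parameter `u ≤ θ` witnesses, through its likelihood ratio, that
the empirical mean is below `θ` and has divergence at least `v` per success. -/
lemma exists_lower_likRatio {θ : ℝ} (hθ : 0 < θ) (hθ1 : θ < 1) {v : ℝ} (hv : 0 ≤ v) :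
    ∃ u : ℝ, 0 < u ∧ u ≤ 1 ∧ ∀ s t : ℕ, 1 ≤ s → s ≤ t → (s : ℝ) / t ≤ θ →
      v ≤ klRate θ (s / t) → Real.exp (s * v) ≤ likRatio θ u s t := by
  by_cases h : ∃ u : ℝ, 0 < u ∧ u ≤ θ ∧ klRate θ u = v
  · obtain ⟨u, hu, huθ, rfl⟩ := h
    refine ⟨u, hu, by linarith, fun s t hs hst hle hv' => ?_⟩
    have ht0 : (0 : ℝ) < t := by exact_mod_cast hs.trans hst
    have hxu : (s : ℝ) / t ≤ u := by
      by_contra hlt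
      exact absurd hv' (not_le.2 (klRate_lt_of_lt_of_le hθ1 hu (not_le.1 hlt) hle))
    refine exp_mul_klRate_le_likRatio_of_le hθ1 hu huθ hst ?_
    rw [div_le_iff₀ hu, mul_comm]
    exact (div_le_iff₀ ht0).1 hxu
  · refine ⟨1, one_pos, le_rfl, fun s t hs hst hle hv' => (h ?_).elim⟩
    have ht0 : (0 : ℝ) < t := by exact_mod_cast hs.trans hst
    have hs0 : (0 : ℝ) < s := by exact_mod_cast hs
    have hx : (0 : ℝ) < s / t := by positivity
    have hc : ContinuousOn (klRate θ) (Set.Icc ((s : ℝ) / t) θ) :=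
      (continuousOn_klRate hθ hθ1).mono fun z hz => ⟨hx.trans_le hz.1, hz.2.trans hθ1.le⟩
    obtain ⟨u, hu, huv⟩ := intermediate_value_Icc' hle hc ⟨by rwa [klRate_self hθ], hv'⟩
    exact ⟨u, hx.trans_le hu.1, hu.2, huv⟩

/-- The counterpart of `exists_lower_likRatio` for empirical means above `θ`. -/
lemma exists_upper_likRatio {θ : ℝ} (hθ : 0 < θ) (hθ1 : θ < 1) {v : ℝ} (hv : 0 ≤ v) :
    ∃ u : ℝ, 0 < u ∧ u ≤ 1 ∧ ∀ s t : ℕ, 1 ≤ s → s ≤ t → θ ≤ (s : ℝ) / t →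
      v ≤ klRate θ (s / t) → Real.exp (s * v) ≤ likRatio θ u s t := by
  by_cases h : ∃ u : ℝ, θ ≤ u ∧ u ≤ 1 ∧ klRate θ u = v
  · obtain ⟨u, huθ, hu1, rfl⟩ := h
    refine ⟨u, by linarith, hu1, fun s t hs hst hle hv' => ?_⟩
    have ht0 : (0 : ℝ) < t := by exact_mod_cast hs.trans hst
    have hxu : u ≤ (s : ℝ) / t := by
      by_contra hlt
      exact absurd hv' (not_le.2 (klRate_lt_of_le_of_lt hθ hle (not_le.1 hlt) hu1))
    refine exp_mul_klRate_le_likRatio_of_ge hθ hθ1 huθ hu1 hst ?_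
    rw [le_div_iff₀ (by linarith), mul_comm]
    exact (le_div_iff₀ ht0).1 hxu
  · refine ⟨1, one_pos, le_rfl, fun s t hs hst hle hv' => (h ?_).elim⟩
    have ht0 : (0 : ℝ) < t := by exact_mod_cast hs.trans hst
    have hx1 : (s : ℝ) / t ≤ 1 := by
      rw [div_le_one ht0]; exact_mod_cast hst
    have hc : ContinuousOn (klRate θ) (Set.Icc θ ((s : ℝ) / t)) :=
      (continuousOn_klRate hθ hθ1).mono fun z hz => ⟨hθ.trans_le hz.1, hz.2.trans hx1⟩
    obtain ⟨u, hu, huv⟩ := intermediate_value_Icc hle hc ⟨by rwa [klRate_self hθ], hv'⟩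
    exact ⟨u, hu.1, hu.2.trans hx1, huv⟩

/-- Polylogarithmically many parameters suffice to recover, up to a factor `e`, the maximal
likelihood ratio `exp (t * klReal (s / t) θ)`, capped at `exp Y`, for all sample sizes `s ≤ n`. The
parameters solve `klRate θ u = j / 2 ^ (m + 1)`, on either side of `θ`, where `m` is the dyadic
scale of `s` and `j ≤ 2 Y`. -/
theorem exists_likRatio_grid {θ : ℝ} (hθ : 0 < θ) (hθ1 : θ < 1) (n : ℕ) (Y : ℝ) :
    ∃ u : Bool × Fin (Nat.log 2 n + 1) × Fin (⌊2 * Y⌋₊ + 1) → ℝ, (∀ k, 0 < u k ∧ u k ≤ 1) ∧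
      ∀ s t : ℕ, 1 ≤ s → s ≤ n → s ≤ t →
        ∃ k, Real.exp (min (t * klReal (s / t) θ) Y - 1) ≤ likRatio θ (u k) s t := by
  choose ul hul hul1 hl using fun (m : Fin (Nat.log 2 n + 1)) (j : Fin (⌊2 * Y⌋₊ + 1)) =>
    exists_lower_likRatio hθ hθ1 (v := (j : ℕ) / 2 ^ ((m : ℕ) + 1)) (by positivity)
  choose uu huu huu1 hu using fun (m : Fin (Nat.log 2 n + 1)) (j : Fin (⌊2 * Y⌋₊ + 1)) =>
    exists_upper_likRatio hθ hθ1 (v := (j : ℕ) / 2 ^ ((m : ℕ) + 1)) (by positivity)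
  refine ⟨fun k => bif k.1 then ul k.2.1 k.2.2 else uu k.2.1 k.2.2, ?_, ?_⟩
  · rintro ⟨_ | _, m, j⟩
    · exact ⟨huu m j, huu1 m j⟩
    · exact ⟨hul m j, hul1 m j⟩
  intro s t hs hsn hst
  have ht0 : (0 : ℝ) < t := by exact_mod_cast hs.trans hst
  have hs0 : (0 : ℝ) < s := by exact_mod_cast hs
  have hx : (0 : ℝ) < s / t := by positivity
  have hx1 : (s : ℝ) / t ≤ 1 := by
    rw [div_le_one ht0]; exact_mod_cast hst
  set r := klRate θ (s / t) with hr
  have hry : (t : ℝ) * klReal (s / t) θ = s * r := by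
    rw [hr, ← mul_klRate hx.ne']; field_simp
  have hr0 : 0 ≤ r := by
    have := klReal_nonneg hx hx1 hθ hθ1
    rw [← mul_klRate hx.ne'] at this
    exact nonneg_of_mul_nonneg_right this hx
  set m := Nat.log 2 s with hm
  have hmn : m < Nat.log 2 n + 1 := Nat.lt_succ_of_le (Nat.log_mono_right hsn)
  have hms : (2 : ℝ) ^ m ≤ s := by exact_mod_cast Nat.pow_log_le_self 2 (by omega)
  have hsm : (s : ℝ) < 2 ^ (m + 1) := by exact_mod_cast Nat.lt_pow_succ_log_self (by norm_num) s
  have hp : (0 : ℝ) < 2 ^ (m + 1) := by positivity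
  set j := min ⌊r * 2 ^ (m + 1)⌋₊ ⌊2 * Y⌋₊ with hj
  have hjY : j < ⌊2 * Y⌋₊ + 1 := Nat.lt_succ_of_le (min_le_right _ _)
  have hv : (j : ℝ) / 2 ^ (m + 1) ≤ r := by
    rw [div_le_iff₀ hp]
    exact le_trans (Nat.cast_le.2 (min_le_left _ _)) (Nat.floor_le (by positivity))
  have hlev : min (t * klReal (s / t) θ) Y - 1 ≤ s * ((j : ℝ) / 2 ^ (m + 1)) := by
    rw [hry]
    rcases min_choice ⌊r * 2 ^ (m + 1)⌋₊ ⌊2 * Y⌋₊ with h | h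
    · have h1 : r * 2 ^ (m + 1) - 1 ≤ j := by
        rw [hj, h]; linarith [Nat.lt_floor_add_one (r * 2 ^ (m + 1))]
      have h2 : s * ((r * 2 ^ (m + 1) - 1) / 2 ^ (m + 1)) ≤ s * ((j : ℝ) / 2 ^ (m + 1)) := by
        gcongr
      have h3 : s * ((r * 2 ^ (m + 1) - 1) / 2 ^ (m + 1)) = s * r - s / 2 ^ (m + 1) := by
        field_simp
      have h4 : (s : ℝ) / 2 ^ (m + 1) ≤ 1 := by rw [div_le_one hp]; exact hsm.le
      have := min_le_left (s * r) Y
      linarith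
    · have h1 : 2 * Y - 1 ≤ j := by
        rw [hj, h]; linarith [Nat.lt_floor_add_one (2 * Y)]
      have h2 : (2 : ℝ) ^ m * ((j : ℝ) / 2 ^ (m + 1)) ≤ s * ((j : ℝ) / 2 ^ (m + 1)) := by
        gcongr
      have h3 : (2 : ℝ) ^ m * ((j : ℝ) / 2 ^ (m + 1)) = j / 2 := by
        rw [pow_succ]; field_simp
      have := min_le_right (s * r) Y
      linarith
  rcases le_total ((s : ℝ) / t) θ with hle | hle
  · exact ⟨(true, ⟨m, hmn⟩, ⟨j, hjY⟩), (Real.exp_le_exp.2 hlev).trans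
      (hl ⟨m, hmn⟩ ⟨j, hjY⟩ s t hs hst hle hv)⟩
  · exact ⟨(false, ⟨m, hmn⟩, ⟨j, hjY⟩), (Real.exp_le_exp.2 hlev).trans
      (hu ⟨m, hmn⟩ ⟨j, hjY⟩ s t hs hst hle hv)⟩

/-! ### Counting rounds -/

/-- If at least a value `v n` holds for at most `A / v n ^ 2` indices, then the `k`-th largest value
is at most `√(A / k)`, and the sum is at most `∑ √(A / k) ≤ 2 √(A #T)`. -/
lemma sum_le_two_mul_sqrt {ι : Type*} {v : ι → ℝ} {A : ℝ} (T : Finset ι)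
    (hv : ∀ n ∈ T, 0 < v n)
    (hA : ∀ n ∈ T, ((T.filter fun k => v n ≤ v k).card : ℝ) * v n ^ 2 ≤ A) :
    ∑ n ∈ T, v n ≤ 2 * √(A * T.card) := by
  classical
  induction hc : T.card generalizing T with
  | zero =>
    rw [Finset.card_eq_zero] at hc
    simp [hc]
  | succ c ih =>
    have hne : T.Nonempty := Finset.card_pos.1 (by omega)
    obtain ⟨m, hm, hmin⟩ := T.exists_min_image v hne
    have hm2 : ((c : ℝ) + 1) * v m ^ 2 ≤ A := by
      have := hA m hm
      rwa [Finset.filter_true_of_mem hmin, hc, Nat.cast_add, Nat.cast_one] at this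
    have hA0 : 0 ≤ A := le_trans (by positivity) hm2
    have ih' := ih (T.erase m) (fun n hn => hv n (Finset.mem_of_mem_erase hn))
      (fun n hn => by
        refine le_trans ?_ (hA n (Finset.mem_of_mem_erase hn))
        gcongr
        exact Finset.erase_subset _ _)
      (by rw [Finset.card_erase_of_mem hm, hc]; rfl)
    rw [← Finset.add_sum_erase T v hm]
    push_cast
    have hvm : v m * √(c + 1) ≤ √A := by
      rw [← Real.sqrt_sq (hv m hm).le, ← Real.sqrt_mul (sq_nonneg _)]
      exact Real.sqrt_le_sqrt (by linarith)
    rw [Real.sqrt_mul hA0] at ih' ⊢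
    -- `1 / √(c + 1) ≤ 2 (√(c + 1) - √c)`
    have h1 : 0 < √((c : ℝ) + 1) := by positivity
    have hq : √((c : ℝ) + 1) ^ 2 = c + 1 := Real.sq_sqrt (by positivity)
    have hq' : √(c : ℝ) ^ 2 = c := Real.sq_sqrt (by positivity)
    have h2 : v m ≤ √A / √(c + 1) := by rwa [le_div_iff₀ h1]
    have h3 : 1 / √((c : ℝ) + 1) ≤ 2 * (√(c + 1) - √c) := by
      rw [div_le_iff₀ h1]
      nlinarith [sq_nonneg (√((c : ℝ) + 1) - √c)]
    have h4 : √A / √(c + 1) ≤ √A * (2 * (√(c + 1) - √c)) := by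
      rw [div_eq_mul_one_div]; gcongr
    linarith

open Classical in
/-- The number of rounds `1 ≤ k < n` that use `i`. For the paths of a run, `RoutingProcess.packets`
is this function by definition. -/
noncomputable def useCount {E : Type*} (P : ℕ → Finset E) (n : ℕ) (i : E) : ℕ :=
  ∑ k ∈ Finset.Ico 1 n, if i ∈ P k then 1 else 0

lemma useCount_mono {E : Type*} (P : ℕ → Finset E) {m n : ℕ} (hmn : m ≤ n) (i : E) :
    useCount P m i ≤ useCount P n i := by
  classical
  exact Finset.sum_le_sum_of_subset (Finset.Ico_subset_Ico_right hmn)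

lemma useCount_lt {E : Type*} {P : ℕ → Finset E} {m n : ℕ} (hm : 1 ≤ m) (hmn : m < n) {i : E}
    (hi : i ∈ P m) : useCount P m i < useCount P n i := by
  classical
  refine lt_of_lt_of_le ?_ (useCount_mono P (Nat.succ_le_of_lt hmn) i)
  unfold useCount
  rw [Nat.succ_eq_add_one, Finset.sum_Ico_succ_top hm, if_pos hi]
  omega

lemma useCount_lt_self {E : Type*} (P : ℕ → Finset E) {n : ℕ} (hn : 1 ≤ n) (i : E) :
    useCount P n i < n := by
  classical
  have : useCount P n i ≤ ∑ k ∈ Finset.Ico 1 n, 1 :=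
    Finset.sum_le_sum fun k _ => by split_ifs <;> simp
  simp at this
  omega

/-- The counts of the successive uses of `i` are pairwise distinct. -/
lemma useCount_injOn {E : Type*} (P : ℕ → Finset E) (i : E) :
    Set.InjOn (fun n => useCount P n i) {n | 1 ≤ n ∧ i ∈ P n} := by
  rintro m ⟨hm, him⟩ n ⟨hn, hin⟩ h
  rcases lt_trichotomy m n with hlt | heq | hlt
  · exact absurd h (useCount_lt hm hlt him).ne
  · exact heq
  · exact absurd h (useCount_lt hn hlt hin).ne'

open Classical in
/-- A link is used at most `a` times while its count lies in `[1, a]`. -/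
lemma card_filter_useCount_le {E : Type*} {P : ℕ → Finset E} {T : Finset ℕ} (hT : ∀ n ∈ T, 1 ≤ n)
    (i : E) {a : ℝ} (ha : 0 ≤ a) :
    ((T.filter fun n => i ∈ P n ∧ 1 ≤ useCount P n i ∧ (useCount P n i : ℝ) ≤ a).card : ℝ) ≤ a := by
  refine le_trans ?_ (Nat.floor_le ha)
  have : ((Finset.Icc 1 ⌊a⌋₊).card : ℝ) = ⌊a⌋₊ := by simp
  rw [← this]
  norm_cast
  refine Finset.card_le_card_of_injOn (fun n => useCount P n i) ?_ ?_
  · intro n hn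
    simp only [Finset.coe_filter, Set.mem_ofPred_eq] at hn
    simp only [Finset.coe_Icc, Set.mem_Icc]
    exact ⟨hn.2.2.1, Nat.le_floor hn.2.2.2⟩
  · refine (useCount_injOn P i).mono fun n hn => ?_
    simp only [Finset.coe_filter, Set.mem_ofPred_eq] at hn
    exact ⟨hT n hn.1, hn.2.1⟩

/-- The number of rounds at which `x ^ 2` is at most `Φ` times the sum of the inverse counts of the
`H` or fewer links in use. Either some link has count at most `a = 2 √H Φ / x ^ 2`, or the links
with count at most `b = 2 H Φ / x ^ 2`, which make up half of the sum, number at least `√H`. -/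
lemma card_le_of_sq_le_sum_inv {E : Type*} [Fintype E] {P : ℕ → Finset E} {T : Finset ℕ} {H : ℕ}
    {Φ x : ℝ} (hT : ∀ n ∈ T, 1 ≤ n) (hΦ : 0 < Φ) (hx : 0 < x)
    (hH : ∀ n ∈ T, (P n).card ≤ H) (hs : ∀ n ∈ T, ∀ i ∈ P n, 1 ≤ useCount P n i)
    (hsum : ∀ n ∈ T, x ^ 2 ≤ Φ * ∑ i ∈ P n, 1 / (useCount P n i : ℝ)) :
    (T.card : ℝ) * x ^ 2 ≤ 4 * Φ * Fintype.card E * √H := by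
  classical
  rcases T.eq_empty_or_nonempty with rfl | ⟨n₀, hn₀⟩
  · simp; positivity
  have hH0 : (0 : ℝ) < H := by
    have : (P n₀).Nonempty := by
      by_contra h
      have := hsum n₀ hn₀
      rw [Finset.not_nonempty_iff_eq_empty.1 h] at this
      simp at this
      nlinarith
    exact_mod_cast (Finset.card_pos.2 this).trans_le (hH n₀ hn₀)
  have hx2 : 0 < x ^ 2 := by positivity
  have hq : 0 < √(H : ℝ) := by positivity
  have hqq : √(H : ℝ) * √H = H := Real.mul_self_sqrt hH0.le
  set a : ℝ := 2 * √H * Φ / x ^ 2 with ha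
  set b : ℝ := 2 * H * Φ / x ^ 2 with hb
  have ha0 : 0 < a := by positivity
  have hb0 : 0 < b := by positivity
  set L : ℝ → E → ℕ → Prop :=
    fun c i n => i ∈ P n ∧ 1 ≤ useCount P n i ∧ (useCount P n i : ℝ) ≤ c with hL
  have hcount : ∀ c : ℝ, 0 ≤ c → ∀ T' ⊆ T,
      ∑ n ∈ T', ((Finset.univ.filter fun i => L c i n).card : ℝ) ≤ Fintype.card E * c := by
    intro c hc T' hT'
    have e : ∑ n ∈ T', ((Finset.univ.filter fun i => L c i n).card : ℝ)
        = ∑ i : E, ((T'.filter fun n => L c i n).card : ℝ) := by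
      simp only [Finset.card_filter]
      push_cast
      exact Finset.sum_comm
    rw [e, ← nsmul_eq_mul, ← Finset.card_univ]
    exact Finset.sum_le_card_nsmul _ _ _ fun i _ =>
      card_filter_useCount_le (fun n hn => hT n (hT' hn)) i hc
  set T₁ := T.filter fun n => ∃ i, L a i n with hT₁
  set T₂ := T.filter fun n => ¬ ∃ i, L a i n with hT₂
  have hc1 : (T₁.card : ℝ) ≤ Fintype.card E * a := by
    refine le_trans ?_ (hcount a ha0.le T₁ (Finset.filter_subset _ _))
    rw [Finset.card_eq_sum_ones]
    push_cast
    refine Finset.sum_le_sum fun n hn => ?_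
    obtain ⟨i, hi⟩ := (Finset.mem_filter.1 hn).2
    exact_mod_cast Finset.card_pos.2 ⟨i, by simpa using hi⟩
  have hc2 : (T₂.card : ℝ) * √H ≤ Fintype.card E * b := by
    refine le_trans ?_ (hcount b hb0.le T₂ (Finset.filter_subset _ _))
    rw [← nsmul_eq_mul]
    refine Finset.card_nsmul_le_sum _ _ _ fun n hn => ?_
    obtain ⟨hnT, hna⟩ := Finset.mem_filter.1 hn
    have hbig : ∀ i ∈ P n, a < useCount P n i := fun i hi => by
      by_contra h
      exact hna ⟨i, hi, hs n hnT i hi, not_lt.1 h⟩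
    have hsplit := Finset.sum_filter_add_sum_filter_not (P n)
      (fun i => (useCount P n i : ℝ) ≤ b) (fun i => 1 / (useCount P n i : ℝ))
    have h1 : ∑ i ∈ (P n).filter (fun i => ¬ (useCount P n i : ℝ) ≤ b), 1 / (useCount P n i : ℝ)
        ≤ H * (1 / b) := by
      refine (Finset.sum_le_card_nsmul _ _ (1 / b) fun i hi => ?_).trans ?_
      · have := not_le.1 (Finset.mem_filter.1 hi).2
        gcongr
      · rw [nsmul_eq_mul]
        gcongr
        exact (Finset.card_filter_le _ _).trans (hH n hnT)
    have h2 : ∑ i ∈ (P n).filter (fun i => (useCount P n i : ℝ) ≤ b), 1 / (useCount P n i : ℝ)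
        ≤ (Finset.univ.filter fun i => L b i n).card * (1 / a) := by
      refine (Finset.sum_le_card_nsmul _ _ (1 / a) fun i hi => ?_).trans ?_
      · have := hbig i (Finset.mem_filter.1 hi).1
        gcongr
      · rw [nsmul_eq_mul]
        gcongr
        intro i hi
        obtain ⟨hiP, hib⟩ := Finset.mem_filter.1 hi
        simpa [hL] using ⟨hiP, hs n hnT i hiP, hib⟩
    have h3 := hsum n hnT
    rw [← hsplit] at h3
    have h4 : Φ * (H * (1 / b)) = x ^ 2 / 2 := by
      rw [hb]; field_simp
    have h5 : x ^ 2 / 2 ≤ Φ * ((Finset.univ.filter fun i => L b i n).card * (1 / a)) := by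
      have := mul_le_mul_of_nonneg_left h1 hΦ.le
      have := mul_le_mul_of_nonneg_left h2 hΦ.le
      linarith
    have h6 : Φ * ((Finset.univ.filter fun i => L b i n).card * (1 / a))
        = x ^ 2 / 2 * ((Finset.univ.filter fun i => L b i n).card / √H) := by
      rw [ha]; field_simp
    rw [h6] at h5
    have h7 : 1 ≤ ((Finset.univ.filter fun i => L b i n).card : ℝ) / √H := by
      by_contra h
      nlinarith
    rwa [le_div_iff₀ hq, one_mul] at h7
  have hT12 : (T.card : ℝ) = T₁.card + T₂.card := by
    exact_mod_cast (Finset.card_filter_add_card_filter_not (s := T) fun n => ∃ i, L a i n).symm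
  have e1 : a * x ^ 2 = 2 * √H * Φ := by rw [ha]; field_simp
  have e2 : b * x ^ 2 = √H * (2 * √H * Φ) := by rw [hb]; field_simp; linarith
  have h8 : T₁.card * x ^ 2 ≤ Fintype.card E * (2 * √H * Φ) := by
    rw [← e1, ← mul_assoc]; gcongr
  have h9 : T₂.card * x ^ 2 ≤ Fintype.card E * (2 * √H * Φ) := by
    have : √H * (T₂.card * x ^ 2) ≤ √H * (Fintype.card E * (2 * √H * Φ)) := by
      calc √H * (T₂.card * x ^ 2) = T₂.card * √H * x ^ 2 := by ring
        _ ≤ Fintype.card E * b * x ^ 2 := by gcongr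
        _ = Fintype.card E * (b * x ^ 2) := by ring
        _ = _ := by rw [e2]; ring
    exact le_of_mul_le_mul_left this hq
  rw [hT12]
  linarith

/-- The sum of the values `v n ≥ m` over rounds at which `v n ^ 2` is at most `Φ` times the sum of
the inverse counts of the links in use. -/
theorem sum_le_of_sq_le_sum_inv {E : Type*} [Fintype E] {P : ℕ → Finset E} {T : Finset ℕ} {H : ℕ}
    {Φ m : ℝ} {v : ℕ → ℝ} (hT : ∀ n ∈ T, 1 ≤ n) (hΦ : 0 < Φ) (hm : 0 < m) (hv : ∀ n ∈ T, m ≤ v n)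
    (hH : ∀ n ∈ T, (P n).card ≤ H) (hs : ∀ n ∈ T, ∀ i ∈ P n, 1 ≤ useCount P n i)
    (hsum : ∀ n ∈ T, v n ^ 2 ≤ Φ * ∑ i ∈ P n, 1 / (useCount P n i : ℝ)) :
    ∑ n ∈ T, v n ≤ 8 * Φ * Fintype.card E * √H / m := by
  classical
  set A := 4 * Φ * Fintype.card E * √H with hA
  have hA0 : 0 ≤ A := by positivity
  have hlev : ∀ x : ℝ, 0 < x → ((T.filter fun k => x ≤ v k).card : ℝ) * x ^ 2 ≤ A := by
    intro x hx
    have hsub : T.filter (fun k => x ≤ v k) ⊆ T := Finset.filter_subset _ _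
    refine card_le_of_sq_le_sum_inv (P := P) (fun n hn => hT n (hsub hn)) hΦ hx
      (fun n hn => hH n (hsub hn)) (fun n hn => hs n (hsub hn)) fun n hn => ?_
    have : x ≤ v n := (Finset.mem_filter.1 hn).2
    exact le_trans (by gcongr) (hsum n (hsub hn))
  have h1 := sum_le_two_mul_sqrt (v := v) (A := A) T (fun n hn => hm.trans_le (hv n hn))
    fun n hn => hlev _ (hm.trans_le (hv n hn))
  have h2 : (T.card : ℝ) ≤ A / m ^ 2 := by
    have := hlev m hm
    rw [Finset.filter_true_of_mem hv] at this
    rwa [le_div_iff₀ (by positivity)]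
  calc ∑ n ∈ T, v n ≤ 2 * √(A * T.card) := h1
    _ ≤ 2 * √((A / m) ^ 2) := by
        gcongr
        calc A * T.card ≤ A * (A / m ^ 2) := by gcongr
          _ = (A / m) ^ 2 := by ring
    _ = 2 * (A / m) := by rw [Real.sqrt_sq (by positivity)]
    _ = 8 * Φ * Fintype.card E * √H / m := by rw [hA]; ring

/-! ### The two indices -/

/-- The likelihood constraint of `bIndex` in real numbers. -/
lemma sum_mul_klReal_le_of_le {E : Type*} {p : Finset E} {t : E → ℕ} {lam u : E → ℝ} {f : ℝ}
    (hf : ((∑ i ∈ p, (t i : ENNReal) * bernoulliKL (lam i) (u i) : ENNReal) : EReal) ≤ f)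
    {q : Finset E}
    (hq : q ⊆ p) (hlam : ∀ i ∈ q, 0 < lam i ∧ lam i ≤ 1) (hu : ∀ i ∈ q, 0 < u i ∧ u i < 1) :
    ∑ i ∈ q, (t i : ℝ) * klReal (lam i) (u i) ≤ f := by
  have hnn : ∀ i ∈ q, 0 ≤ (t i : ℝ) * klReal (lam i) (u i) := fun i hi =>
    mul_nonneg (Nat.cast_nonneg _)
      (klReal_nonneg (hlam i hi).1 (hlam i hi).2 (hu i hi).1 (hu i hi).2)
  have e : ENNReal.ofReal (∑ i ∈ q, (t i : ℝ) * klReal (lam i) (u i))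
      = ∑ i ∈ q, (t i : ENNReal) * bernoulliKL (lam i) (u i) := by
    rw [ENNReal.ofReal_sum_of_nonneg hnn]
    refine Finset.sum_congr rfl fun i hi => ?_
    rw [bernoulliKL_eq_ofReal (hu i hi).1 (hu i hi).2, ENNReal.ofReal_mul (Nat.cast_nonneg _),
      ENNReal.ofReal_natCast]
  have h1 : ENNReal.ofReal (∑ i ∈ q, (t i : ℝ) * klReal (lam i) (u i))
      ≤ ∑ i ∈ p, (t i : ENNReal) * bernoulliKL (lam i) (u i) := by
    rw [e]; exact Finset.sum_le_sum_of_subset hq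
  have h2 := (EReal.coe_ennreal_le_coe_ennreal_iff.2 h1).trans hf
  rw [EReal.coe_ennreal_ofReal, max_eq_left (Finset.sum_nonneg hnn)] at h2
  exact_mod_cast h2

/-- Every parameter `u` that is feasible for `bIndex` has total inverse at least the index `c`: as
`1/u` is convex, `1/x - 1/u ≤ (u - x)/x²`, and the right-hand sides are bounded by Pinsker's
inequality and the Cauchy-Schwarz inequality. -/
theorem sum_inv_sub_sqrt_le {E : Type*} {p : Finset E} {s t : E → ℕ} {lam u : E → ℝ} {f : ℝ}
    (hs : ∀ i ∈ p, 1 ≤ s i) (hst : ∀ i ∈ p, s i ≤ t i)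
    (hlam : ∀ i ∈ p, lam i = s i / t i) (hu : ∀ i ∈ p, 0 < u i ∧ u i ≤ 1)
    (hf : ((∑ i ∈ p, (t i : ENNReal) * bernoulliKL (lam i) (u i) : ENNReal) : EReal) ≤ f) :
    ∑ i ∈ p, (lam i)⁻¹ - √(f / 2 * ∑ i ∈ p, 1 / ((s i : ℝ) * lam i ^ 3)) ≤ ∑ i ∈ p, (u i)⁻¹ := by
  classical
  have hs0 : ∀ i ∈ p, (0 : ℝ) < s i := fun i hi => by exact_mod_cast hs i hi
  have ht0 : ∀ i ∈ p, (0 : ℝ) < t i := fun i hi => by exact_mod_cast (hs i hi).trans (hst i hi)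
  have hl0 : ∀ i ∈ p, 0 < lam i := fun i hi => by
    rw [hlam i hi]; exact div_pos (hs0 i hi) (ht0 i hi)
  have hl1 : ∀ i ∈ p, lam i ≤ 1 := fun i hi => by
    rw [hlam i hi, div_le_one (ht0 i hi)]; exact_mod_cast hst i hi
  set q := p.filter fun i => u i < 1 with hq
  have hqp : q ⊆ p := Finset.filter_subset _ _
  have hqf : ∑ i ∈ q, (t i : ℝ) * klReal (lam i) (u i) ≤ f :=
    sum_mul_klReal_le_of_le hf hqp (fun i hi => ⟨hl0 i (hqp hi), hl1 i (hqp hi)⟩)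
      fun i hi => ⟨(hu i (hqp hi)).1, (Finset.mem_filter.1 hi).2⟩
  -- A link with `u i = 1` has finite divergence only if `lam i = 1`.
  have hone : ∀ i ∈ p, i ∉ q → lam i = u i := by
    intro i hi hiq
    have hu1 : u i = 1 := by
      by_contra h
      exact hiq (Finset.mem_filter.2 ⟨hi, lt_of_le_of_ne (hu i hi).2 h⟩)
    by_contra h
    have htop : (t i : ENNReal) * bernoulliKL (lam i) (u i) = ⊤ := by
      have : bernoulliKL (lam i) (u i) = ⊤ := by
        unfold bernoulliKL; rw [if_pos]; exact Or.inr ⟨hu1, hu1 ▸ h⟩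
      rw [this, ENNReal.mul_top]
      have := ht0 i hi
      exact_mod_cast this.ne'
    rw [ENNReal.sum_eq_top.2 ⟨i, hi, htop⟩] at hf
    simp at hf
  have hpin : ∑ i ∈ p, 2 * (t i : ℝ) * (u i - lam i) ^ 2 ≤ f := by
    refine le_trans ?_ hqf
    rw [← Finset.sum_subset hqp fun i hi hiq => by rw [hone i hi hiq]; ring]
    refine Finset.sum_le_sum fun i hi => ?_
    have := two_mul_sq_le_klReal (hl0 i (hqp hi)) (hl1 i (hqp hi)) (hu i (hqp hi)).1
      (Finset.mem_filter.1 hi).2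
    have := mul_le_mul_of_nonneg_left this (ht0 i (hqp hi)).le
    linarith
  have hconv : ∀ i ∈ p, (lam i)⁻¹ - (u i)⁻¹
      ≤ √(2 * t i) * (u i - lam i) * (1 / (√(2 * t i) * lam i ^ 2)) := by
    intro i hi
    have h1 := hl0 i hi
    have h2 := (hu i hi).1
    have h3 : 0 < √(2 * (t i : ℝ)) := by have := ht0 i hi; positivity
    have e : √(2 * t i) * (u i - lam i) * (1 / (√(2 * t i) * lam i ^ 2))
        = (u i - lam i) / lam i ^ 2 := by field_simp
    rw [e, ← sub_nonneg]
    have e2 : (u i - lam i) / lam i ^ 2 - ((lam i)⁻¹ - (u i)⁻¹)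
        = (u i - lam i) ^ 2 / (u i * lam i ^ 2) := by
      field_simp
    rw [e2]; positivity
  have hcs := Finset.sum_mul_sq_le_sq_mul_sq p (fun i => √(2 * t i) * (u i - lam i))
    (fun i => 1 / (√(2 * t i) * lam i ^ 2))
  have e1 : ∑ i ∈ p, (√(2 * t i) * (u i - lam i)) ^ 2
      = ∑ i ∈ p, 2 * (t i : ℝ) * (u i - lam i) ^ 2 :=
    Finset.sum_congr rfl fun i hi => by
      rw [mul_pow, Real.sq_sqrt (by positivity)]
  have e2 : ∑ i ∈ p, (1 / (√(2 * t i) * lam i ^ 2)) ^ 2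
      = 1 / 2 * ∑ i ∈ p, 1 / ((s i : ℝ) * lam i ^ 3) := by
    rw [Finset.mul_sum]
    refine Finset.sum_congr rfl fun i hi => ?_
    have h1 := hs0 i hi
    have h2 := ht0 i hi
    have h3 := hl0 i hi
    have h4 : (s i : ℝ) = t i * lam i := by rw [hlam i hi]; field_simp
    rw [div_pow, mul_pow, Real.sq_sqrt (by positivity), h4]
    field_simp
  rw [e1, e2] at hcs
  have hsum0 : 0 ≤ ∑ i ∈ p, 1 / ((s i : ℝ) * lam i ^ 3) := Finset.sum_nonneg fun i hi => by
    have := hs0 i hi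
    have := hl0 i hi
    positivity
  have hfin : ∑ i ∈ p, √(2 * t i) * (u i - lam i) * (1 / (√(2 * t i) * lam i ^ 2))
      ≤ √(f / 2 * ∑ i ∈ p, 1 / ((s i : ℝ) * lam i ^ 3)) := by
    refine Real.le_sqrt_of_sq_le (hcs.trans ?_)
    calc _ ≤ f * (1 / 2 * ∑ i ∈ p, 1 / ((s i : ℝ) * lam i ^ 3)) := by gcongr
      _ = _ := by ring
  have := Finset.sum_le_sum hconv
  rw [Finset.sum_sub_distrib] at this
  linarith

/-- The index `c` is at most the index `b`. -/
theorem cIndex_le_bIndex {E : Type*} (H n : ℕ) {p : Finset E} {s t : E → ℕ} {lam : E → ℝ}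
    (hst : ∀ i ∈ p, s i ≤ t i) (hlam : ∀ i ∈ p, 1 ≤ s i → lam i = s i / t i) :
    cIndex H n s lam p ≤ bIndex H n t lam p := by
  classical
  unfold cIndex
  split_ifs with h
  · exact bot_le
  have hs : ∀ i ∈ p, 1 ≤ s i := fun i hi => Nat.one_le_iff_ne_zero.2 fun h0 => h ⟨i, hi, h0⟩
  unfold bIndex
  refine le_iInf₂ fun u hu => EReal.coe_le_coe_iff.2 ?_
  exact sum_inv_sub_sqrt_le hs hst (fun i hi => hlam i hi (hs i hi)) (fun i _ => hu.1 i) hu.2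

/-- If the true parameter is feasible, the index `b` of a path is at most its average delay. -/
lemma bIndex_le_pathDelay {E : Type*} [Fintype E] {H n : ℕ} {p : Finset E} {t : E → ℕ}
    {lam θ : E → ℝ} (hθ : ∀ i, 0 < θ i ∧ θ i ≤ 1)
    (hf : ((∑ i ∈ p, (t i : ENNReal) * bernoulliKL (lam i) (θ i) : ENNReal) : EReal)
      ≤ (f₁ H n : ℝ)) :
    bIndex H n t lam p ≤ (Network.pathDelay θ p : ℝ) :=
  iInf₂_le (f := fun (u : E → ℝ) _ => ((∑ i ∈ p, (u i)⁻¹ : ℝ) : EReal)) θ ⟨hθ, hf⟩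

/-- A path whose index `c` is at most `D` and whose links have estimates of relative accuracy `ε`
has average delay close to `D`, unless some of its links have been used rarely. -/
lemma sq_le_of_cIndex_le {E : Type*} [Fintype E] {H n : ℕ} {p : Finset E} {s : E → ℕ}
    {lam θ : E → ℝ} {ε D δ m f : ℝ} (hδ : 0 < δ) (hε : 0 < ε) (hε1 : ε < 1)
    (hm : 0 < m) (hmθ : ∀ i ∈ p, m ≤ θ i) (hs : ∀ i ∈ p, 1 ≤ s i)
    (hlo : ∀ i ∈ p, (1 - ε) * θ i ≤ lam i) (hup : ∀ i ∈ p, lam i ≤ (1 + ε) * θ i)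
    (hc : cIndex H n s lam p ≤ (D : ℝ)) (hf : f₁ H n ≤ f)
    (hD : 0 ≤ D) (hgap : δ ≤ Network.pathDelay θ p - D) (hεδ : ε * D < δ) :
    (Network.pathDelay θ p - D) ^ 2 ≤
      (1 + ε) ^ 2 / ((1 - ε) ^ 3 * (1 - ε * D / δ) ^ 2) * f / (2 * m ^ 3) *
        ∑ i ∈ p, 1 / (s i : ℝ) := by
  classical
  have hs0 : ∀ i ∈ p, (0 : ℝ) < s i := fun i hi => by exact_mod_cast hs i hi
  have hθ0 : ∀ i ∈ p, 0 < θ i := fun i hi => hm.trans_le (hmθ i hi)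
  have h1ε : 0 < 1 - ε := by linarith
  have hl0 : ∀ i ∈ p, 0 < lam i := fun i hi =>
    (mul_pos h1ε (hθ0 i hi)).trans_le (hlo i hi)
  unfold cIndex at hc
  rw [if_neg (fun ⟨i, hi, h0⟩ => by have := hs i hi; omega), EReal.coe_le_coe_iff] at hc
  set g := Network.pathDelay θ p - D with hg
  have hg0 : 0 < g := hδ.trans_le hgap
  have hb : 0 < 1 - ε * D / δ := by rw [sub_pos, div_lt_one hδ]; exact hεδ
  have h1 : Network.pathDelay θ p / (1 + ε) ≤ ∑ i ∈ p, (lam i)⁻¹ := by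
    rw [Network.pathDelay, Finset.sum_div]
    refine Finset.sum_le_sum fun i hi => ?_
    have := hθ0 i hi
    have := hl0 i hi
    rw [div_eq_mul_inv, ← mul_inv, mul_comm]
    exact inv_anti₀ this (hup i hi)
  set S := ∑ i ∈ p, 1 / (s i : ℝ) with hS
  have hS0 : 0 ≤ S := Finset.sum_nonneg fun i _ => by positivity
  have h2 : ∑ i ∈ p, 1 / ((s i : ℝ) * lam i ^ 3) ≤ S / ((1 - ε) * m) ^ 3 := by
    rw [hS, Finset.sum_div]
    refine Finset.sum_le_sum fun i hi => ?_
    rw [div_div]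
    have := hs0 i hi
    have : (1 - ε) * m ≤ lam i := le_trans (by gcongr; exact hmθ i hi) (hlo i hi)
    gcongr
  -- `D_p / (1 + ε) - D = (Δ_p - ε D) / (1 + ε)`, and `ε D ≤ (ε D / δ) Δ_p`
  have h3 : g * (1 - ε * D / δ) / (1 + ε)
      ≤ √(f₁ H n / 2 * ∑ i ∈ p, 1 / ((s i : ℝ) * lam i ^ 3)) := by
    have e : g * (1 - ε * D / δ) / (1 + ε) ≤ Network.pathDelay θ p / (1 + ε) - D := by
      have e1 : Network.pathDelay θ p / (1 + ε) - D = (g - ε * D) / (1 + ε) := by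
        rw [hg]; field_simp; ring
      rw [e1]
      gcongr
      have : ε * D ≤ g * (ε * D / δ) := by
        rw [mul_div_assoc', le_div_iff₀ hδ, mul_comm g]
        gcongr
      linarith
    linarith
  have hpos : 0 < g * (1 - ε * D / δ) / (1 + ε) := by positivity
  have h4 : (g * (1 - ε * D / δ) / (1 + ε)) ^ 2
      ≤ f₁ H n / 2 * ∑ i ∈ p, 1 / ((s i : ℝ) * lam i ^ 3) := (Real.le_sqrt' hpos).1 h3
  have hsum0 : 0 ≤ ∑ i ∈ p, 1 / ((s i : ℝ) * lam i ^ 3) := Finset.sum_nonneg fun i hi => by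
    have := hs0 i hi
    have := hl0 i hi
    positivity
  have hf0 : 0 ≤ f := by
    by_contra hneg
    have : f₁ H n / 2 * ∑ i ∈ p, 1 / ((s i : ℝ) * lam i ^ 3) ≤ 0 :=
      mul_nonpos_of_nonpos_of_nonneg (by linarith) hsum0
    have := pow_pos hpos 2
    linarith
  have h5 : f₁ H n / 2 * ∑ i ∈ p, 1 / ((s i : ℝ) * lam i ^ 3)
      ≤ f / 2 * (S / ((1 - ε) * m) ^ 3) := by
    gcongr
  have h6 := h4.trans h5
  have e : (1 + ε) ^ 2 / ((1 - ε) ^ 3 * (1 - ε * D / δ) ^ 2) * f / (2 * m ^ 3) * S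
      = (f / 2 * (S / ((1 - ε) * m) ^ 3)) / ((1 - ε * D / δ) / (1 + ε)) ^ 2 := by
    field_simp
  rw [e, le_div_iff₀ (by positivity)]
  calc _ = (g * (1 - ε * D / δ) / (1 + ε)) ^ 2 := by ring
    _ ≤ _ := h6

/-! ### Delays and likelihood-ratio martingales -/

lemma tsum_ofReal_geometric {u : ℝ} (hu : 0 < u) (hu1 : u ≤ 1) :
    ∑' k : ℕ, ENNReal.ofReal ((1 - u) ^ k * u) = 1 := by
  have h0 : 0 ≤ 1 - u := by linarith
  have h1 : 1 - u < 1 := by linarith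
  rw [← ENNReal.ofReal_tsum_of_nonneg (fun k => by positivity)
    ((summable_geometric_of_lt_one h0 h1).mul_right u), tsum_mul_right,
    tsum_geometric_of_lt_one h0 h1, sub_sub_cancel, inv_mul_cancel₀ hu.ne', ENNReal.ofReal_one]

/-- The likelihood ratio of the geometric laws with success probabilities `u` and `θ` at the delay
`d ≥ 1`. -/
noncomputable def likFactor (θ u : ℝ) (d : ℕ) : ENNReal :=
  ENNReal.ofReal (u / θ * ((1 - u) / (1 - θ)) ^ (d - 1))

/-- The product of the likelihood ratios of the delays `d k ≥ 1`, `k ∈ S`. -/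
lemma prod_likFactor {θ u : ℝ} (hθ : 0 < θ) (hθ1 : θ < 1) (hu : 0 < u) (hu1 : u ≤ 1)
    {S : Finset ℕ} {d : ℕ → ℕ} (hd : ∀ k ∈ S, 1 ≤ d k) :
    ∏ k ∈ S, likFactor θ u (d k) = ENNReal.ofReal (likRatio θ u S.card (∑ k ∈ S, d k)) := by
  have h1 : 0 ≤ (1 - u) / (1 - θ) := div_nonneg (by linarith) (by linarith)
  unfold likFactor
  rw [← ENNReal.ofReal_prod_of_nonneg (fun k _ => by positivity), Finset.prod_mul_distrib,
    Finset.prod_const, Finset.prod_pow_eq_pow_sum, likRatio, Finset.sum_tsub_distrib _ hd]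
  simp

namespace RoutingProcess

variable {V E : Type*} [Fintype E] {G : Network V E} {θ : E → ℝ}
  {Ω : Type*} [MeasurableSpace Ω] {μ : Measure Ω}

lemma measurable_delay (R : RoutingProcess G θ μ) (n : ℕ) (i : E) :
    Measurable (R.delay (n + 1) i) :=
  (R.delay_past n i).mono (R.past.le _) le_rfl

lemma measurable_delay_comap (R : RoutingProcess G θ μ) (n : ℕ) (i : E) :
    Measurable[MeasurableSpace.comap (fun ω i => R.delay (n + 1) i ω) inferInstance]
      (R.delay (n + 1) i) := by
  have h := (measurable_pi_apply (X := fun _ : E => ℕ) i).comp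
    (comap_measurable (fun ω i => R.delay (n + 1) i ω))
  exact h

lemma comap_delay_le (R : RoutingProcess G θ μ) (n : ℕ) :
    MeasurableSpace.comap (fun ω i => R.delay (n + 1) i ω) inferInstance
      ≤ (inferInstance : MeasurableSpace Ω) :=
  (measurable_pi_lambda _ fun i => R.measurable_delay n i).comap_le

lemma measurableSet_path (R : RoutingProcess G θ μ) (n : ℕ) (q : Finset E) :
    MeasurableSet {ω | R.path (n + 1) ω = q} :=
  R.past.le _ _ (R.path_past n q)

lemma delay_eq_zero_null [IsProbabilityMeasure μ] (R : RoutingProcess G θ μ)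
    (hθ : ∀ i, 0 < θ i ∧ θ i ≤ 1) (n : ℕ) (i : E) : μ {ω | R.delay (n + 1) i ω = 0} = 0 := by
  have hm := R.measurable_delay n i
  have h1 : μ {ω | R.delay (n + 1) i ω = 0}ᶜ = 1 := by
    have e : {ω | R.delay (n + 1) i ω = 0}ᶜ = ⋃ k : ℕ, {ω | R.delay (n + 1) i ω = k + 1} := by
      ext ω
      simp only [Set.mem_compl_iff, Set.mem_ofPred_eq, Set.mem_iUnion]
      exact Nat.pos_iff_ne_zero.symm.trans Nat.exists_eq_add_one.symm
    rw [e, measure_iUnion]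
    · simp_rw [R.delay_law]
      exact tsum_ofReal_geometric (hθ i).1 (hθ i).2
    · intro j k hjk
      refine Set.disjoint_left.2 fun ω h1 h2 => hjk ?_
      simp only [Set.mem_ofPred_eq] at h1 h2
      omega
    · exact fun k => hm (measurableSet_singleton (k + 1))
  have h0 : MeasurableSet {ω | R.delay (n + 1) i ω = 0} := hm (measurableSet_singleton 0)
  exact (prob_compl_eq_one_iff h0).1 h1

lemma lintegral_delay [IsProbabilityMeasure μ] (R : RoutingProcess G θ μ)
    (hθ : ∀ i, 0 < θ i ∧ θ i ≤ 1) (n : ℕ) (i : E) (F : ℕ → ENNReal) :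
    ∫⁻ ω, F (R.delay (n + 1) i ω) ∂μ
      = ∑' k : ℕ, F (k + 1) * ENNReal.ofReal ((1 - θ i) ^ k * θ i) := by
  have hm := R.measurable_delay n i
  have hF : Measurable F := measurable_of_countable F
  have e : ∀ k : ℕ, (μ.map (R.delay (n + 1) i)) {k} = μ {ω | R.delay (n + 1) i ω = k} :=
    fun k => Measure.map_apply hm (measurableSet_singleton k)
  rw [← lintegral_map hF hm, lintegral_countable', tsum_eq_zero_add' ENNReal.summable]
  simp_rw [e, R.delay_eq_zero_null hθ, R.delay_law, mul_zero, zero_add]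

/-- Delays are at least one attempt, and exactly one on a link that never fails. -/
lemma ae_one_le_delay [IsProbabilityMeasure μ] (R : RoutingProcess G θ μ)
    (hθ : ∀ i, 0 < θ i ∧ θ i ≤ 1) :
    ∀ᵐ ω ∂μ, ∀ n, 1 ≤ n → ∀ i, 1 ≤ R.delay n i ω ∧ (θ i = 1 → R.delay n i ω = 1) := by
  have h : ∀ n i, ∀ᵐ ω ∂μ, 1 ≤ R.delay (n + 1) i ω ∧ (θ i = 1 → R.delay (n + 1) i ω = 1) := by
    intro n i
    have h0 : ∀ᵐ ω ∂μ, ¬ R.delay (n + 1) i ω = 0 := by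
      rw [ae_iff]; simpa using R.delay_eq_zero_null hθ n i
    by_cases h1 : θ i = 1
    · have h2 : ∀ k : ℕ, ∀ᵐ ω ∂μ, ¬ R.delay (n + 1) i ω = k + 1 + 1 := by
        intro k
        rw [ae_iff]; simpa [h1] using R.delay_law n i (k + 1)
      filter_upwards [h0, ae_all_iff.2 h2] with ω h3 h4
      have : R.delay (n + 1) i ω = 1 := by
        by_contra h5
        exact h4 (R.delay (n + 1) i ω - 2) (by omega)
      exact ⟨this.ge, fun _ => this⟩
    · filter_upwards [h0] with ω h3
      exact ⟨by omega, fun h => absurd h h1⟩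
  filter_upwards [ae_all_iff.2 fun n => ae_all_iff.2 (h n)] with ω hω n hn i
  obtain ⟨m, rfl⟩ := Nat.exists_eq_add_of_le' hn
  exact hω m i

lemma lintegral_likFactor [IsProbabilityMeasure μ] (R : RoutingProcess G θ μ)
    (hθ : ∀ i, 0 < θ i ∧ θ i ≤ 1) (n : ℕ) {i : E} (hi : θ i < 1) {u : ℝ}
    (hu : 0 < u) (hu1 : u ≤ 1) :
    ∫⁻ ω, likFactor (θ i) u (R.delay (n + 1) i ω) ∂μ = 1 := by
  rw [R.lintegral_delay hθ n i, ← tsum_ofReal_geometric hu hu1]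
  refine tsum_congr fun k => ?_
  have h0 := (hθ i).1
  have h1 : 0 < 1 - θ i := by linarith
  have h2 : 0 ≤ (1 - u) / (1 - θ i) := div_nonneg (by linarith) h1.le
  rw [likFactor, ← ENNReal.ofReal_mul (by positivity), Nat.add_sub_cancel, div_pow]
  congr 1
  field_simp

lemma lintegral_natCast_delay [IsProbabilityMeasure μ] (R : RoutingProcess G θ μ)
    (hθ : ∀ i, 0 < θ i ∧ θ i ≤ 1) (n : ℕ) (i : E) :
    ∫⁻ ω, (R.delay (n + 1) i ω : ENNReal) ∂μ = ENNReal.ofReal (θ i)⁻¹ := by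
  have h0 : 0 ≤ 1 - θ i := by linarith [(hθ i).2]
  have h1 : ‖1 - θ i‖ < 1 := by rw [Real.norm_of_nonneg h0]; linarith [(hθ i).1]
  rw [R.lintegral_delay hθ n i (fun d => (d : ENNReal))]
  have e : ∀ k : ℕ, ((k + 1 : ℕ) : ENNReal) * ENNReal.ofReal ((1 - θ i) ^ k * θ i)
      = ENNReal.ofReal (((k : ℝ) * (1 - θ i) ^ k + (1 - θ i) ^ k) * θ i) := by
    intro k
    rw [← ENNReal.ofReal_natCast, ← ENNReal.ofReal_mul (Nat.cast_nonneg _)]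
    congr 1; push_cast; ring
  have hs : HasSum (fun k : ℕ => ((k : ℝ) * (1 - θ i) ^ k + (1 - θ i) ^ k) * θ i) (θ i)⁻¹ := by
    have e : (θ i)⁻¹ = ((1 - θ i) / (1 - (1 - θ i)) ^ 2 + (1 - (1 - θ i))⁻¹) * θ i := by
      have := (hθ i).1.ne'
      rw [sub_sub_cancel]
      field_simp
      ring
    rw [e]
    exact ((hasSum_coe_mul_geometric_of_norm_lt_one h1).add
      (hasSum_geometric_of_norm_lt_one h1)).mul_right (θ i)
  simp_rw [e]
  rw [← ENNReal.ofReal_tsum_of_nonneg _ hs.summable, hs.tsum_eq]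
  intro k
  have := (hθ i).1
  positivity

/-- The fundamental supermartingale bound: the expected product of the weights `g i` of the delays
on predictable sets `J k` of links is at most one, if each weight has expectation at most one. -/
theorem lintegral_prod_le_one [IsProbabilityMeasure μ] (R : RoutingProcess G θ μ)
    {J : ℕ → Ω → Finset E} (hJ : ∀ n q, MeasurableSet[R.past n] {ω | J (n + 1) ω = q})
    {Q : Finset E} (hJQ : ∀ n ω, J n ω ⊆ Q) {g : E → ℕ → ENNReal}
    (hg : ∀ n, ∀ i ∈ Q, ∫⁻ ω, g i (R.delay (n + 1) i ω) ∂μ ≤ 1) (n : ℕ) :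
    Measurable[R.past n] (fun ω => ∏ k ∈ Finset.Ico 1 (n + 1), ∏ i ∈ J k ω, g i (R.delay k i ω)) ∧
      ∫⁻ ω, ∏ k ∈ Finset.Ico 1 (n + 1), ∏ i ∈ J k ω, g i (R.delay k i ω) ∂μ ≤ 1 := by
  classical
  induction n with
  | zero => simp
  | succ n ih =>
    obtain ⟨ihm, ih⟩ := ih
    have hgm : ∀ i, Measurable (g i) := fun i => measurable_of_countable _
    set Z : Ω → ENNReal := fun ω => ∏ k ∈ Finset.Ico 1 (n + 1), ∏ i ∈ J k ω, g i (R.delay k i ω)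
      with hZ
    set X : Finset E → Ω → ENNReal := fun q ω => ∏ i ∈ q, g i (R.delay (n + 1) i ω) with hX
    set Y : Finset E → Ω → ENNReal := fun q => {ω | J (n + 1) ω = q}.indicator Z with hY
    have hsplit : ∀ ω, ∏ k ∈ Finset.Ico 1 (n + 1 + 1), ∏ i ∈ J k ω, g i (R.delay k i ω)
        = ∑ q ∈ Q.powerset, Y q ω * X q ω := by
      intro ω
      rw [Finset.prod_Ico_succ_top (by omega), Finset.sum_eq_single (J (n + 1) ω)]
      · simp [hY, hX, hZ]
      · intro q _ hq
        have : Y q ω = 0 :=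
          Set.indicator_of_notMem (s := {ω | J (n + 1) ω = q}) (fun h => hq (Eq.symm h)) _
        rw [this, zero_mul]
      · intro h
        exact absurd (Finset.mem_powerset.2 (hJQ _ _)) h
    have hYm : ∀ q, Measurable[R.past n] (Y q) := fun q => ihm.indicator (hJ n q)
    have hXm' : ∀ q, Measurable[R.past (n + 1)] (X q) := fun q =>
      Finset.measurable_fun_prod _ fun i _ => (hgm i).comp (R.delay_past n i)
    have hXm : ∀ q, Measurable[MeasurableSpace.comap (fun ω i => R.delay (n + 1) i ω) inferInstance]
        (X q) := fun q =>
      Finset.measurable_fun_prod _ fun i _ =>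
        (hgm i).comp (R.measurable_delay_comap n i)
    have hle := R.comap_delay_le n
    simp_rw [hsplit]
    refine ⟨Finset.measurable_fun_sum _ fun q _ =>
      ((hYm q).mono (R.past.mono n.le_succ) le_rfl).mul (hXm' q), ?_⟩
    rw [lintegral_finsetSum (f := fun q ω => Y q ω * X q ω) _ fun q _ =>
      ((hYm q).mono (R.past.le _) le_rfl).mul ((hXm q).mono hle le_rfl)]
    calc ∑ q ∈ Q.powerset, ∫⁻ ω, Y q ω * X q ω ∂μ
        ≤ ∑ q ∈ Q.powerset, ∫⁻ ω, Y q ω ∂μ := by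
          refine Finset.sum_le_sum fun q hq => ?_
          rw [lintegral_mul_eq_lintegral_mul_lintegral_of_independent_measurableSpace
            (R.past.le n) hle (R.delay_indep_past n).symm (hYm q) (hXm q)]
          refine mul_le_of_le_one_right' ?_
          have hind : iIndepFun (fun i ω => g i (R.delay (n + 1) i ω)) μ :=
            (R.delay_indep_links n).comp g hgm
          rw [lintegral_prod_eq_prod_lintegral_of_indepFun q _ hind
            fun i => (hgm i).comp (R.measurable_delay n i)]
          exact Finset.prod_le_one' fun i hi => hg n i (Finset.mem_powerset.1 hq hi)
      _ = ∫⁻ ω, Z ω ∂μ := by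
          rw [← lintegral_finsetSum _ fun q _ => (hYm q).mono (R.past.le _) le_rfl]
          refine lintegral_congr fun ω => ?_
          rw [Finset.sum_eq_single (J (n + 1) ω)]
          · simp [hY]
          · intro q _ hq
            exact Set.indicator_of_notMem (fun h => hq h.symm) _
          · intro h
            exact absurd (Finset.mem_powerset.2 (hJQ _ _)) h
      _ ≤ 1 := ih

/-! ### The expected delay of a packet -/

/-- The path of a packet is independent of the delays it meets. -/
lemma lintegral_indicator_delay [IsProbabilityMeasure μ] (R : RoutingProcess G θ μ)
    (hθ : ∀ i, 0 < θ i ∧ θ i ≤ 1) (n : ℕ) (i : E) (q : Finset E) :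
    ∫⁻ ω, {ω | R.path (n + 1) ω = q}.indicator (fun ω => (R.delay (n + 1) i ω : ENNReal)) ω ∂μ
      = μ {ω | R.path (n + 1) ω = q} * ENNReal.ofReal (θ i)⁻¹ := by
  have hle := R.comap_delay_le n
  have hdm : Measurable[MeasurableSpace.comap (fun ω i => R.delay (n + 1) i ω) inferInstance]
      (fun ω => (R.delay (n + 1) i ω : ENNReal)) :=
    (measurable_of_countable (fun d : ℕ => (d : ENNReal))).comp
      (R.measurable_delay_comap n i)
  have hpm : Measurable[R.past n] ({ω | R.path (n + 1) ω = q}.indicator (1 : Ω → ENNReal)) :=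
    (@measurable_const _ _ _ (R.past n) (1 : ENNReal)).indicator (R.path_past n q)
  have h := lintegral_mul_eq_lintegral_mul_lintegral_of_independent_measurableSpace
    (R.past.le n) hle (R.delay_indep_past n).symm hpm hdm
  rw [R.lintegral_natCast_delay hθ, lintegral_indicator_one (R.measurableSet_path n q)] at h
  rw [← h]
  refine lintegral_congr fun ω => ?_
  by_cases hω : R.path (n + 1) ω = q <;> simp [hω]

lemma totalDelay_eq_sum (R : RoutingProcess G θ μ) (n : ℕ) (ω : Ω) :
    R.totalDelay n ω
      = ∑ q ∈ G.paths, ∑ i ∈ q,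
        {ω | R.path n ω = q}.indicator (fun ω => (R.delay n i ω : ℝ)) ω := by
  rw [Finset.sum_eq_single (R.path n ω)]
  · simp [totalDelay]
  · intro q _ hq
    exact Finset.sum_eq_zero fun i _ => Set.indicator_of_notMem (fun h => hq h.symm) _
  · exact fun h => absurd (R.path_mem n ω) h

lemma integrable_indicator_delay [IsProbabilityMeasure μ] (R : RoutingProcess G θ μ)
    (hθ : ∀ i, 0 < θ i ∧ θ i ≤ 1) (n : ℕ) (i : E) (q : Finset E) :
    Integrable ({ω | R.path (n + 1) ω = q}.indicator (fun ω => (R.delay (n + 1) i ω : ℝ))) μ ∧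
    ∫ ω, {ω | R.path (n + 1) ω = q}.indicator (fun ω => (R.delay (n + 1) i ω : ℝ)) ω ∂μ
      = μ.real {ω | R.path (n + 1) ω = q} * (θ i)⁻¹ := by
  have hm : Measurable ({ω | R.path (n + 1) ω = q}.indicator
      (fun ω => (R.delay (n + 1) i ω : ℝ))) :=
    ((measurable_of_countable (fun d : ℕ => (d : ℝ))).comp (R.measurable_delay n i)).indicator
      (R.measurableSet_path n q)
  have hnn : 0 ≤ {ω | R.path (n + 1) ω = q}.indicator (fun ω => (R.delay (n + 1) i ω : ℝ)) :=
    Set.indicator_nonneg fun ω _ => Nat.cast_nonneg _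
  have e : ∫⁻ ω, ENNReal.ofReal
      ({ω | R.path (n + 1) ω = q}.indicator (fun ω => (R.delay (n + 1) i ω : ℝ)) ω) ∂μ
      = μ {ω | R.path (n + 1) ω = q} * ENNReal.ofReal (θ i)⁻¹ := by
    rw [← R.lintegral_indicator_delay hθ]
    refine lintegral_congr fun ω => ?_
    by_cases hω : R.path (n + 1) ω = q <;> simp [hω]
  have hfin : μ {ω | R.path (n + 1) ω = q} * ENNReal.ofReal (θ i)⁻¹ ≠ ⊤ :=
    ENNReal.mul_ne_top (measure_ne_top _ _) ENNReal.ofReal_ne_top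
  constructor
  · refine ⟨hm.aestronglyMeasurable, ?_⟩
    rw [hasFiniteIntegral_iff_ofReal (Filter.Eventually.of_forall hnn), e]
    exact hfin.lt_top
  · rw [integral_eq_lintegral_of_nonneg_ae (Filter.Eventually.of_forall hnn)
      hm.aestronglyMeasurable, e, ENNReal.toReal_mul,
      ENNReal.toReal_ofReal (inv_nonneg.2 (hθ i).1.le)]
    rfl

lemma integrable_totalDelay [IsProbabilityMeasure μ] (R : RoutingProcess G θ μ)
    (hθ : ∀ i, 0 < θ i ∧ θ i ≤ 1) (n : ℕ) : Integrable (R.totalDelay (n + 1)) μ := by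
  have e : R.totalDelay (n + 1) = fun ω => ∑ q ∈ G.paths, ∑ i ∈ q,
      {ω | R.path (n + 1) ω = q}.indicator (fun ω => (R.delay (n + 1) i ω : ℝ)) ω :=
    funext fun ω => R.totalDelay_eq_sum (n + 1) ω
  rw [e]
  exact integrable_finsetSum _ fun q _ => integrable_finsetSum _ fun i _ =>
    (R.integrable_indicator_delay hθ n i q).1

/-- A function of the path of a packet is bounded and measurable. -/
lemma integrable_comp_path [IsProbabilityMeasure μ] (R : RoutingProcess G θ μ) (n : ℕ)
    (F : Finset E → ℝ) :
    Integrable (fun ω => F (R.path (n + 1) ω)) μ ∧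
    ∫ ω, F (R.path (n + 1) ω) ∂μ = ∑ q ∈ G.paths, μ.real {ω | R.path (n + 1) ω = q} * F q := by
  have e : (fun ω => F (R.path (n + 1) ω))
      = fun ω => ∑ q ∈ G.paths, {ω | R.path (n + 1) ω = q}.indicator (fun _ => F q) ω := by
    funext ω
    rw [Finset.sum_eq_single (R.path (n + 1) ω)]
    · simp
    · intro q _ hq
      exact Set.indicator_of_notMem (fun h => hq h.symm) _
    · exact fun h => absurd (R.path_mem _ ω) h
  have hi : ∀ q ∈ G.paths, Integrable ({ω | R.path (n + 1) ω = q}.indicator (fun _ => F q)) μ :=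
    fun q _ => (integrable_const _).indicator (R.measurableSet_path n q)
  rw [e]
  refine ⟨integrable_finsetSum _ hi, ?_⟩
  rw [integral_finsetSum _ hi]
  refine Finset.sum_congr rfl fun q _ => ?_
  rw [integral_indicator_const _ (R.measurableSet_path n q), smul_eq_mul]

lemma integral_totalDelay [IsProbabilityMeasure μ] (R : RoutingProcess G θ μ)
    (hθ : ∀ i, 0 < θ i ∧ θ i ≤ 1) (n : ℕ) :
    ∫ ω, R.totalDelay (n + 1) ω ∂μ = ∫ ω, Network.pathDelay θ (R.path (n + 1) ω) ∂μ := by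
  rw [(R.integrable_comp_path n _).2]
  simp_rw [R.totalDelay_eq_sum]
  rw [integral_finsetSum _ fun q _ => integrable_finsetSum _ fun i _ =>
    (R.integrable_indicator_delay hθ n i q).1]
  refine Finset.sum_congr rfl fun q _ => ?_
  rw [integral_finsetSum _ fun i _ => (R.integrable_indicator_delay hθ n i q).1,
    Network.pathDelay, Finset.mul_sum]
  exact Finset.sum_congr rfl fun i _ => (R.integrable_indicator_delay hθ n i q).2

theorem regret_eq_integral_gap [IsProbabilityMeasure μ] (R : RoutingProcess G θ μ)
    (hθ : ∀ i, 0 < θ i ∧ θ i ≤ 1) (N : ℕ) :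
    R.regret N = ∫ ω, ∑ n ∈ Finset.Icc 1 N, G.gap θ (R.path n ω) ∂μ := by
  have h1 : ∀ n ∈ Finset.Icc 1 N, ∃ m, n = m + 1 := fun n hn =>
    Nat.exists_eq_add_of_le' (Finset.mem_Icc.1 hn).1
  have hD : ∀ n ∈ Finset.Icc 1 N, Integrable (R.totalDelay n) μ := fun n hn => by
    obtain ⟨m, rfl⟩ := h1 n hn
    exact R.integrable_totalDelay hθ m
  have hP : ∀ F : Finset E → ℝ, ∀ n ∈ Finset.Icc 1 N, Integrable (fun ω => F (R.path n ω)) μ :=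
    fun F n hn => by
      obtain ⟨m, rfl⟩ := h1 n hn
      exact (R.integrable_comp_path m F).1
  rw [regret, integral_finsetSum _ hD, integral_finsetSum _ (hP _)]
  have e : (N : ℝ) * G.optDelay θ = ∑ n ∈ Finset.Icc 1 N, G.optDelay θ := by simp
  rw [e, ← Finset.sum_sub_distrib]
  refine Finset.sum_congr rfl fun n hn => ?_
  have hi := hP (Network.pathDelay θ) n hn
  obtain ⟨m, rfl⟩ := h1 n hn
  simp only [Network.gap]
  rw [integral_sub hi (integrable_const _), R.integral_totalDelay hθ]
  simp

end RoutingProcess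

/-! ### Auxiliary inequalities -/

/-- Markov's inequality at the exponential scale. -/
lemma measure_exp_le {Ω : Type*} [MeasurableSpace Ω] {μ : Measure Ω}
    {Z : Ω → ENNReal} (hZ : Measurable Z)
    (h1 : ∫⁻ ω, Z ω ∂μ ≤ 1) (r : ℝ) :
    MeasurableSet {ω | ENNReal.ofReal (Real.exp r) ≤ Z ω} ∧
      μ {ω | ENNReal.ofReal (Real.exp r) ≤ Z ω} ≤ ENNReal.ofReal (Real.exp (-r)) := by
  refine ⟨measurableSet_le measurable_const hZ, ?_⟩
  have hpos : ENNReal.ofReal (Real.exp r) ≠ 0 := by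
    simp [ENNReal.ofReal_eq_zero, Real.exp_pos]
  refine (meas_ge_le_lintegral_div hZ.aemeasurable hpos ENNReal.ofReal_ne_top).trans ?_
  rw [Real.exp_neg, ENNReal.ofReal_inv_of_pos (Real.exp_pos r), ENNReal.div_eq_inv_mul]
  exact mul_le_of_le_one_right' h1

/-- Capping the terms of a sum at `Y` does not bring a sum of at least `Y` below `Y`. -/
lemma le_sum_min {ι : Type*} {Q : Finset ι} {y : ι → ℝ} {Y : ℝ} (hY : 0 ≤ Y)
    (hy : ∀ i ∈ Q, 0 ≤ y i) (h : Y ≤ ∑ i ∈ Q, y i) : Y ≤ ∑ i ∈ Q, min (y i) Y := by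
  by_cases hex : ∃ i ∈ Q, Y ≤ y i
  · obtain ⟨i, hi, hiY⟩ := hex
    calc Y = min (y i) Y := (min_eq_right hiY).symm
      _ ≤ _ := Finset.single_le_sum (f := fun i => min (y i) Y)
        (fun j hj => le_min (hy j hj) hY) hi
  · push Not at hex
    rwa [Finset.sum_congr rfl fun i hi => min_eq_left (hex i hi).le]

namespace RoutingProcess

variable {V E : Type*} [Fintype E] {G : Network V E} {θ : E → ℝ}
  {Ω : Type*} [MeasurableSpace Ω] {μ : Measure Ω}

/-! ### Counts and estimates of a run -/

open Classical in
lemma packets_eq_card (R : RoutingProcess G θ μ) (n : ℕ) (ω : Ω) (i : E) :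
    R.packets n ω i = ((Finset.Ico 1 n).filter fun k => i ∈ R.path k ω).card := by
  rw [packets, Finset.card_filter]

open Classical in
lemma attempts_eq_sum (R : RoutingProcess G θ μ) (n : ℕ) (ω : Ω) (i : E) :
    R.attempts n ω i = ∑ k ∈ (Finset.Ico 1 n).filter fun k => i ∈ R.path k ω, R.delay k i ω := by
  rw [attempts, Finset.sum_filter]

lemma packets_le_attempts {R : RoutingProcess G θ μ} {ω : Ω}
    (hd : ∀ n, 1 ≤ n → ∀ i, 1 ≤ R.delay n i ω ∧ (θ i = 1 → R.delay n i ω = 1)) (n : ℕ) (i : E) :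
    R.packets n ω i ≤ R.attempts n ω i := by
  unfold packets attempts
  refine Finset.sum_le_sum fun k hk => ?_
  split_ifs
  · exact (hd k (Finset.mem_Ico.1 hk).1 i).1
  · exact le_rfl

lemma attempts_eq_packets {R : RoutingProcess G θ μ} {ω : Ω}
    (hd : ∀ n, 1 ≤ n → ∀ i, 1 ≤ R.delay n i ω ∧ (θ i = 1 → R.delay n i ω = 1)) (n : ℕ) {i : E}
    (hi : θ i = 1) : R.attempts n ω i = R.packets n ω i := by
  unfold packets attempts
  refine Finset.sum_congr rfl fun k hk => ?_
  rw [(hd k (Finset.mem_Ico.1 hk).1 i).2 hi]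

lemma attempts_eq_zero {R : RoutingProcess G θ μ} {ω : Ω} {n : ℕ} {i : E}
    (h : R.packets n ω i = 0) : R.attempts n ω i = 0 := by
  classical
  rw [packets_eq_card, Finset.card_eq_zero] at h
  rw [attempts_eq_sum, h, Finset.sum_empty]

lemma empirical_eq_div {R : RoutingProcess G θ μ} {ω : Ω}
    (hd : ∀ n, 1 ≤ n → ∀ i, 1 ≤ R.delay n i ω ∧ (θ i = 1 → R.delay n i ω = 1)) {n : ℕ} {i : E}
    (h : 1 ≤ R.packets n ω i) :
    R.empirical n ω i = (R.packets n ω i : ℝ) / R.attempts n ω i := by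
  rw [empirical, if_pos]
  exact h.trans (packets_le_attempts hd n i)

lemma measurableSet_path_mem (R : RoutingProcess G θ μ) (n : ℕ) (S : Set (Finset E)) :
    MeasurableSet[R.past n] {ω | R.path (n + 1) ω ∈ S} := by
  have e : {ω | R.path (n + 1) ω ∈ S} = ⋃ q ∈ S, {ω | R.path (n + 1) ω = q} := by
    ext ω; simp
  rw [e]
  exact MeasurableSet.biUnion (Set.to_countable S) fun q _ => R.path_past n q

lemma measurable_packets (R : RoutingProcess G θ μ) (n : ℕ) (i : E) :
    Measurable[R.past n] (fun ω => R.packets (n + 1) ω i) := by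
  classical
  unfold packets
  refine Finset.measurable_fun_sum _ fun k hk => ?_
  obtain ⟨m, rfl⟩ := Nat.exists_eq_add_of_le' (Finset.mem_Ico.1 hk).1
  have hm : m ≤ n := by have := (Finset.mem_Ico.1 hk).2; omega
  refine Measurable.ite ?_ measurable_const measurable_const
  exact R.past.mono hm _ (R.measurableSet_path_mem m {q | i ∈ q})

/-! ### Concentration on a path -/

open Classical in
/-- The likelihood ratio, after the packets before `n`, of the parameters `u` against `θ` on the
links in `Q`. -/
noncomputable def likProd (R : RoutingProcess G θ μ) (Q : Finset E) (u : E → ℝ) (n : ℕ) (ω : Ω) :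
    ENNReal :=
  ∏ k ∈ Finset.Ico 1 n, ∏ i ∈ R.path k ω ∩ Q, likFactor (θ i) (u i) (R.delay k i ω)

lemma likProd_eq {R : RoutingProcess G θ μ} {ω : Ω}
    (hd : ∀ n, 1 ≤ n → ∀ i, 1 ≤ R.delay n i ω ∧ (θ i = 1 → R.delay n i ω = 1)) {Q : Finset E}
    (hQ : ∀ i ∈ Q, 0 < θ i ∧ θ i < 1) {u : E → ℝ} (hu : ∀ i, 0 < u i ∧ u i ≤ 1) (n : ℕ) :
    R.likProd Q u n ω = ∏ i ∈ Q,
      ENNReal.ofReal (likRatio (θ i) (u i) (R.packets n ω i) (R.attempts n ω i)) := by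
  classical
  unfold likProd
  rw [Finset.prod_comm' (t' := Q) (s' := fun i => (Finset.Ico 1 n).filter fun k => i ∈ R.path k ω)
    (by intro k i; simp only [Finset.mem_inter, Finset.mem_filter]; tauto)]
  refine Finset.prod_congr rfl fun i hi => ?_
  rw [prod_likFactor (hQ i hi).1 (hQ i hi).2 (hu i).1 (hu i).2
    (fun k hk => (hd k (Finset.mem_Ico.1 (Finset.mem_filter.1 hk).1).1 i).1),
    packets_eq_card, attempts_eq_sum]

lemma likProd_bound [IsProbabilityMeasure μ] (R : RoutingProcess G θ μ)
    (hθ : ∀ i, 0 < θ i ∧ θ i ≤ 1) {Q : Finset E} (hQ : ∀ i ∈ Q, θ i < 1) {u : E → ℝ}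
    (hu : ∀ i, 0 < u i ∧ u i ≤ 1) (n : ℕ) :
    Measurable (R.likProd Q u (n + 1)) ∧ ∫⁻ ω, R.likProd Q u (n + 1) ω ∂μ ≤ 1 := by
  classical
  have h := R.lintegral_prod_le_one (J := fun k ω => R.path k ω ∩ Q)
    (fun n q => R.measurableSet_path_mem n {q' | q' ∩ Q = q}) (Q := Q)
    (fun n ω => Finset.inter_subset_right) (g := fun i => likFactor (θ i) (u i))
    (fun n i hi => (R.lintegral_likFactor hθ n (hQ i hi) (hu i).1 (hu i).2).le) n
  exact ⟨h.1.mono (R.past.le n) le_rfl, h.2⟩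

/-- The true parameter violates the constraint of the index `b` on a path with at most `H` links
with small probability: a violation forces one of the likelihood-ratio martingales of a
polylogarithmic grid of alternative parameters on each link to be large. -/
theorem exists_feasible_event [IsProbabilityMeasure μ] (R : RoutingProcess G θ μ)
    (hθ : ∀ i, 0 < θ i ∧ θ i ≤ 1) {p : Finset E} {H : ℕ} (hp : p.card ≤ H) {n : ℕ} (hn : 1 ≤ n)
    {Y : ℝ} (hY : 0 ≤ Y) :
    ∃ A : Set Ω, MeasurableSet A ∧
      μ.real A ≤ (2 * ((Nat.log 2 n + 1) * (⌊2 * Y⌋₊ + 1)) : ℕ) ^ H * Real.exp (H - Y) ∧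
      ∀ᵐ ω ∂μ, ω ∉ A → ((∑ i ∈ p, (R.attempts n ω i : ENNReal) *
        bernoulliKL (R.empirical n ω i) (θ i) : ENNReal) : EReal) ≤ Y := by
  classical
  set Q := p.filter fun i => θ i < 1 with hQdef
  have hQ : ∀ i ∈ Q, θ i < 1 := fun i hi => (Finset.mem_filter.1 hi).2
  have hQp : Q ⊆ p := Finset.filter_subset _ _
  have hQH : Q.card ≤ H := (Finset.card_le_card hQp).trans hp
  let ι := Bool × Fin (Nat.log 2 n + 1) × Fin (⌊2 * Y⌋₊ + 1)
  have hι : Fintype.card ι = 2 * ((Nat.log 2 n + 1) * (⌊2 * Y⌋₊ + 1)) := by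
    simp [ι]
  have hgrid : ∀ i : E, ∃ U : ι → ℝ, (∀ k, 0 < U k ∧ U k ≤ 1) ∧ (θ i < 1 →
      ∀ s t : ℕ, 1 ≤ s → s ≤ n → s ≤ t →
        ∃ k, Real.exp (min (t * klReal (s / t) (θ i)) Y - 1) ≤ likRatio (θ i) (U k) s t) := by
    intro i
    by_cases hi : θ i < 1
    · obtain ⟨U, hU, hU'⟩ := exists_likRatio_grid (hθ i).1 hi n Y
      exact ⟨U, hU, fun _ => hU'⟩
    · exact ⟨fun _ => 1, fun _ => ⟨one_pos, le_rfl⟩, fun h => absurd h hi⟩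
  choose U hU hUg using hgrid
  let k₀ : ι := (true, 0, 0)
  set C : Finset (E → ι) := Fintype.piFinset fun i => if i ∈ Q then Finset.univ else {k₀} with hC
  have hCcard : C.card ≤ (Fintype.card ι) ^ H := by
    rw [hC, Fintype.card_piFinset]
    have : ∀ i, (if i ∈ Q then (Finset.univ : Finset ι) else {k₀}).card
        = if i ∈ Q then Fintype.card ι else 1 := by
      intro i; split_ifs <;> simp
    simp_rw [this]
    rw [Finset.prod_ite_mem, Finset.univ_inter, Finset.prod_const]
    exact Nat.pow_le_pow_right (Fintype.card_pos_iff.2 ⟨k₀⟩) hQH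
  obtain ⟨m, rfl⟩ := Nat.exists_eq_add_of_le' hn
  have hZ := fun c : E → ι => R.likProd_bound hθ hQ (u := fun i => U i (c i))
    (fun i => hU i (c i)) m
  have hM := fun c : E → ι => measure_exp_le (μ := μ) (hZ c).1 (hZ c).2 (Y - H)
  refine ⟨⋃ c ∈ C, {ω | ENNReal.ofReal (Real.exp (Y - H))
      ≤ R.likProd Q (fun i => U i (c i)) (m + 1) ω},
    Finset.measurableSet_biUnion _ fun c _ => (hM c).1, ?_, ?_⟩
  · calc μ.real _ ≤ ∑ c ∈ C, μ.real {ω | ENNReal.ofReal (Real.exp (Y - H))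
          ≤ R.likProd Q (fun i => U i (c i)) (m + 1) ω} :=
          measureReal_biUnion_finset_le _ _
      _ ≤ ∑ c ∈ C, Real.exp (H - Y) := by
          refine Finset.sum_le_sum fun c _ => ENNReal.toReal_le_of_le_ofReal (Real.exp_pos _).le ?_
          rw [← neg_sub Y (H : ℝ)]
          exact (hM c).2
      _ = C.card * Real.exp (H - Y) := by rw [Finset.sum_const, nsmul_eq_mul]
      _ ≤ _ := by
          rw [← hι]
          gcongr
          exact_mod_cast hCcard
  · filter_upwards [R.ae_one_le_delay hθ] with ω hd hω
    set s := R.packets (m + 1) ω with hs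
    set t := R.attempts (m + 1) ω with ht
    set lam := R.empirical (m + 1) ω with hlam
    have hst : ∀ i, s i ≤ t i := fun i => packets_le_attempts hd _ i
    have hlam' : ∀ i, 1 ≤ s i → lam i = s i / t i := fun i hi => empirical_eq_div hd hi
    have hy0 : ∀ i ∈ Q, 0 ≤ (t i : ℝ) * klReal (lam i) (θ i) := by
      intro i hi
      rcases Nat.eq_zero_or_pos (s i) with h0 | h0
      · rw [ht, attempts_eq_zero h0]; simp
      · have h1 : (0 : ℝ) < s i := by exact_mod_cast h0
        have h2 : (0 : ℝ) < t i := h1.trans_le (by exact_mod_cast hst i)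
        refine mul_nonneg h2.le (klReal_nonneg ?_ ?_ (hθ i).1 (hQ i hi))
        · rw [hlam' i h0]; positivity
        · rw [hlam' i h0, div_le_one h2]; exact_mod_cast hst i
    have hle : ∑ i ∈ p, (t i : ENNReal) * bernoulliKL (lam i) (θ i)
        ≤ ENNReal.ofReal (∑ i ∈ Q, (t i : ℝ) * klReal (lam i) (θ i)) := by
      rw [ENNReal.ofReal_sum_of_nonneg hy0, ← Finset.sum_subset hQp]
      · refine Finset.sum_le_sum fun i hi => ?_
        rw [bernoulliKL_eq_ofReal (hθ i).1 (hQ i hi), ENNReal.ofReal_mul (Nat.cast_nonneg _),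
          ENNReal.ofReal_natCast]
      · intro i hi hiQ
        have h1 : θ i = 1 := le_antisymm (hθ i).2
          (not_lt.1 fun h => hiQ (Finset.mem_filter.2 ⟨hi, h⟩))
        rcases Nat.eq_zero_or_pos (s i) with h0 | h0
        · rw [ht, attempts_eq_zero h0]; simp
        · have h2 : (s i : ℝ) ≠ 0 := by exact_mod_cast h0.ne'
          have h3 : t i = s i := attempts_eq_packets hd _ h1
          rw [hlam' i h0, h3, div_self h2, h1, bernoulliKL_one_one, mul_zero]
    refine (EReal.coe_ennreal_le_coe_ennreal_iff.2 hle).trans ?_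
    rw [EReal.coe_ennreal_ofReal, EReal.coe_le_coe_iff]
    refine max_le ?_ hY
    by_contra hgt
    push Not at hgt
    refine hω ?_
    have hk : ∀ i, ∃ k, i ∈ Q →
        Real.exp (min (t i * klReal (lam i) (θ i)) Y - 1) ≤ likRatio (θ i) (U i k) (s i) (t i) := by
      intro i
      by_cases hi : i ∈ Q
      · rcases Nat.eq_zero_or_pos (s i) with h0 | h0
        · refine ⟨k₀, fun _ => ?_⟩
          have h1 : t i = 0 := attempts_eq_zero h0
          simp [h0, h1, likRatio, hY]
        · obtain ⟨k, hk⟩ := hUg i (hQ i hi) (s i) (t i) h0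
            (useCount_lt_self _ (by omega) i).le (hst i)
          exact ⟨k, fun _ => by rw [hlam' i h0]; exact hk⟩
      · exact ⟨k₀, fun h => absurd h hi⟩
    choose c hc using hk
    refine Set.mem_iUnion₂.2 ⟨fun i => if i ∈ Q then c i else k₀, ?_, ?_⟩
    · rw [hC, Fintype.mem_piFinset]
      intro i
      split_ifs <;> simp
    · show ENNReal.ofReal (Real.exp (Y - H)) ≤ _
      rw [likProd_eq hd (fun i hi => ⟨(hθ i).1, hQ i hi⟩) fun i => hU i _]
      calc ENNReal.ofReal (Real.exp (Y - H))
          ≤ ENNReal.ofReal (∏ i ∈ Q, Real.exp (min (t i * klReal (lam i) (θ i)) Y - 1)) := by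
            rw [← Real.exp_sum, Finset.sum_sub_distrib]
            have h1 := le_sum_min hY hy0 hgt.le
            have h2 : (Q.card : ℝ) ≤ H := by exact_mod_cast hQH
            gcongr
            simpa using h2
        _ = ∏ i ∈ Q, ENNReal.ofReal (Real.exp (min (t i * klReal (lam i) (θ i)) Y - 1)) :=
            ENNReal.ofReal_prod_of_nonneg fun i _ => (Real.exp_pos _).le
        _ ≤ _ := by
            refine Finset.prod_le_prod' fun i hi => ENNReal.ofReal_le_ofReal ?_
            simp only [if_pos hi]
            exact hc i hi

/-! ### Accuracy of the estimate of a link -/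

open Classical in
/-- The likelihood ratio of `u` against `θ i` after the first `s` uses of link `i`, or after all of
its uses up to packet `n - 1` if there are fewer. -/
noncomputable def stoppedLikProd (R : RoutingProcess G θ μ) (i : E) (s : ℕ) (u : ℝ) (n : ℕ)
    (ω : Ω) : ENNReal :=
  ∏ k ∈ Finset.Ico 1 n, ∏ j ∈ if i ∈ R.path k ω ∧ R.packets k ω i < s then {i} else ∅,
    likFactor (θ j) u (R.delay k j ω)

lemma stoppedLikProd_eq {R : RoutingProcess G θ μ} {ω : Ω}
    (hd : ∀ n, 1 ≤ n → ∀ i, 1 ≤ R.delay n i ω ∧ (θ i = 1 → R.delay n i ω = 1)) {i : E}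
    (hi : 0 < θ i ∧ θ i < 1) {u : ℝ} (hu : 0 < u) (hu1 : u ≤ 1) {n N : ℕ} (hnN : n ≤ N) :
    R.stoppedLikProd i (R.packets n ω i) u N ω
      = ENNReal.ofReal (likRatio (θ i) u (R.packets n ω i) (R.attempts n ω i)) := by
  classical
  have e : (Finset.Ico 1 N).filter
      (fun k => i ∈ R.path k ω ∧ R.packets k ω i < R.packets n ω i)
      = (Finset.Ico 1 n).filter fun k => i ∈ R.path k ω := by
    ext k
    simp only [Finset.mem_filter, Finset.mem_Ico]
    constructor
    · rintro ⟨⟨h1, -⟩, hk, hlt⟩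
      refine ⟨⟨h1, ?_⟩, hk⟩
      by_contra hkn
      exact absurd (useCount_mono (fun k => R.path k ω) (not_lt.1 hkn) i) (not_le.2 hlt)
    · rintro ⟨⟨h1, h2⟩, hk⟩
      exact ⟨⟨h1, h2.trans_le hnN⟩, hk, useCount_lt (P := fun k => R.path k ω) h1 h2 hk⟩
  have e2 : R.stoppedLikProd i (R.packets n ω i) u N ω
      = ∏ k ∈ (Finset.Ico 1 n).filter fun k => i ∈ R.path k ω,
        likFactor (θ i) u (R.delay k i ω) := by
    rw [← e, Finset.prod_filter, stoppedLikProd]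
    refine Finset.prod_congr rfl fun k _ => ?_
    split_ifs <;> simp
  rw [e2, prod_likFactor hi.1 hi.2 hu hu1
    (fun k hk => (hd k (Finset.mem_Ico.1 (Finset.mem_filter.1 hk).1).1 i).1),
    packets_eq_card, attempts_eq_sum]

lemma stoppedLikProd_bound [IsProbabilityMeasure μ] (R : RoutingProcess G θ μ)
    (hθ : ∀ i, 0 < θ i ∧ θ i ≤ 1) {i : E} (hi : θ i < 1) {u : ℝ} (hu : 0 < u) (hu1 : u ≤ 1)
    (s n : ℕ) :
    Measurable (R.stoppedLikProd i s u (n + 1)) ∧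
      ∫⁻ ω, R.stoppedLikProd i s u (n + 1) ω ∂μ ≤ 1 := by
  classical
  have h := R.lintegral_prod_le_one
    (J := fun k ω => if i ∈ R.path k ω ∧ R.packets k ω i < s then {i} else ∅)
    (fun n q => by
      have hC : MeasurableSet[R.past n]
          {ω | i ∈ R.path (n + 1) ω ∧ R.packets (n + 1) ω i < s} :=
        (R.measurableSet_path_mem n {q | i ∈ q}).inter
          (R.measurable_packets n i (measurableSet_Iio (a := s)))
      have e : {ω | (if i ∈ R.path (n + 1) ω ∧ R.packets (n + 1) ω i < s then ({i} : Finset E)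
          else ∅) = q}
          = ({ω | i ∈ R.path (n + 1) ω ∧ R.packets (n + 1) ω i < s} ∩ {_ω | ({i} : Finset E) = q}) ∪
            ({ω | i ∈ R.path (n + 1) ω ∧ R.packets (n + 1) ω i < s}ᶜ ∩
              {_ω | (∅ : Finset E) = q}) := by
        ext ω
        by_cases h : i ∈ R.path (n + 1) ω ∧ R.packets (n + 1) ω i < s <;> simp [h]
      rw [e]
      exact (hC.inter (MeasurableSet.const _)).union (hC.compl.inter (MeasurableSet.const _)))
    (Q := {i}) (fun n ω => by split_ifs <;> simp)
    (g := fun i => likFactor (θ i) u)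
    (fun n j hj => by
      obtain rfl := Finset.mem_singleton.1 hj
      exact (R.lintegral_likFactor hθ n hi hu hu1).le) n
  exact ⟨h.1.mono (R.past.le n) le_rfl, h.2⟩

/-- After `s` uses, the estimate of a link has relative accuracy `ε`, except with exponentially
small probability. -/
theorem exists_accurate_event [IsProbabilityMeasure μ] (R : RoutingProcess G θ μ)
    (hθ : ∀ i, 0 < θ i ∧ θ i ≤ 1) (i : E) {ε : ℝ} (hε : 0 < ε) (hε1 : ε < 1) {s : ℕ} (hs : 1 ≤ s)
    (N : ℕ) :
    ∃ B : Set Ω, MeasurableSet B ∧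
      μ.real B ≤ Real.exp (-(2 * (ε ^ 2 * θ i) * s)) + Real.exp (-(ε ^ 2 * θ i * s)) ∧
      ∀ᵐ ω ∂μ, ω ∉ B → ∀ n ≤ N, R.packets n ω i = s →
        (1 - ε) * θ i ≤ R.empirical n ω i ∧ R.empirical n ω i ≤ (1 + ε) * θ i := by
  classical
  have h0 := (hθ i).1
  have hs0 : (0 : ℝ) < s := by exact_mod_cast hs
  rcases eq_or_lt_of_le (hθ i).2 with h1 | h1
  · refine ⟨∅, MeasurableSet.empty, by simp; positivity, ?_⟩
    filter_upwards [R.ae_one_le_delay hθ] with ω hd _ n _ hns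
    rw [empirical_eq_div hd (hns.symm ▸ hs), attempts_eq_packets hd _ h1, hns, div_self hs0.ne', h1]
    constructor <;> linarith
  -- the lower deviation
  have hul : 0 < (1 - ε) * θ i := mul_pos (by linarith) h0
  have hul' : (1 - ε) * θ i ≤ θ i := by nlinarith
  have hZl := R.stoppedLikProd_bound hθ h1 hul (by linarith) s N
  have hMl := measure_exp_le (μ := μ) hZl.1 hZl.2 (2 * (ε ^ 2 * θ i) * s)
  have hrl : 2 * (ε ^ 2 * θ i) ≤ klRate (θ i) ((1 - ε) * θ i) := by
    have hp := two_mul_sq_le_klReal hul (by linarith) h0 h1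
    rw [← mul_klRate hul.ne'] at hp
    refine le_of_mul_le_mul_left (le_trans ?_ hp) hul
    have : 0 < ε ^ 3 * θ i ^ 2 := by positivity
    nlinarith
  -- the upper deviation, with a parameter truncated at `1`
  set v := min ((1 + ε) * θ i) 1 with hv
  have hvθ : θ i ≤ v := le_min (by nlinarith) h1.le
  have hv1 : v ≤ 1 := min_le_right _ _
  have hZu := R.stoppedLikProd_bound hθ h1 (h0.trans_le hvθ) hv1 s N
  have hMu := measure_exp_le (μ := μ) hZu.1 hZu.2 (ε ^ 2 * θ i * s)
  refine ⟨{ω | ENNReal.ofReal (Real.exp (2 * (ε ^ 2 * θ i) * s))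
        ≤ R.stoppedLikProd i s ((1 - ε) * θ i) (N + 1) ω} ∪
      {ω | ENNReal.ofReal (Real.exp (ε ^ 2 * θ i * s)) ≤ R.stoppedLikProd i s v (N + 1) ω},
    hMl.1.union hMu.1, ?_, ?_⟩
  · refine (measureReal_union_le _ _).trans (add_le_add ?_ ?_)
    · exact ENNReal.toReal_le_of_le_ofReal (Real.exp_pos _).le hMl.2
    · exact ENNReal.toReal_le_of_le_ofReal (Real.exp_pos _).le hMu.2
  · filter_upwards [R.ae_one_le_delay hθ] with ω hd hω n hnN hns
    have hst : s ≤ R.attempts n ω i := hns ▸ packets_le_attempts hd n i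
    have ht0 : (0 : ℝ) < R.attempts n ω i := by exact_mod_cast hs.trans hst
    rw [empirical_eq_div hd (hns.symm ▸ hs), hns]
    have hN : n ≤ N + 1 := hnN.trans N.le_succ
    constructor
    · by_contra hlt
      push Not at hlt
      refine hω (Or.inl ?_)
      show _ ≤ R.stoppedLikProd i s ((1 - ε) * θ i) (N + 1) ω
      rw [← hns, stoppedLikProd_eq hd ⟨h0, h1⟩ hul (by linarith) hN, hns]
      refine ENNReal.ofReal_le_ofReal (le_trans ?_
        (exp_mul_klRate_le_likRatio_of_le h1 hul hul' hst ?_))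
      · rw [mul_comm (s : ℝ)]; gcongr
      · rw [div_le_iff₀ hul, mul_comm]
        exact ((div_lt_iff₀ ht0).1 hlt).le
    · by_contra hlt
      push Not at hlt
      have hle1 : (s : ℝ) / R.attempts n ω i ≤ 1 := by
        rw [div_le_one ht0]; exact_mod_cast hst
      have hv' : v = (1 + ε) * θ i := min_eq_left (hlt.trans_le hle1).le
      have hru : ε ^ 2 * θ i ≤ klRate (θ i) v := by
        have hp := two_mul_sq_le_klReal (h0.trans_le hvθ) hv1 h0 h1
        rw [← mul_klRate (h0.trans_le hvθ).ne'] at hp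
        refine le_of_mul_le_mul_left (le_trans ?_ hp) (h0.trans_le hvθ)
        rw [hv']
        have : 0 ≤ (1 - ε) * (ε ^ 2 * θ i ^ 2) := mul_nonneg (by linarith) (by positivity)
        nlinarith
      refine hω (Or.inr ?_)
      show _ ≤ R.stoppedLikProd i s v (N + 1) ω
      rw [← hns, stoppedLikProd_eq hd ⟨h0, h1⟩ (h0.trans_le hvθ) hv1 hN, hns]
      refine ENNReal.ofReal_le_ofReal (le_trans ?_
        (exp_mul_klRate_le_likRatio_of_ge h0 h1 hvθ hv1 hst ?_))
      · rw [mul_comm (s : ℝ)]; gcongr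
      · rw [le_div_iff₀ (h0.trans_le hvθ), mul_comm, hv']
        exact ((lt_div_iff₀ ht0).1 hlt).le

end RoutingProcess

/-! ### Summing the probabilities -/

/-- The probability bound of `exists_feasible_event` at the threshold `f₁ H n` is summable in `n`,
with a sum that depends only on `H`. -/
lemma feasible_bound_le {H n : ℕ} (hH : 1 ≤ H) (hn : 3 ≤ n) :
    ((2 * ((Nat.log 2 n + 1) * (⌊2 * f₁ H n⌋₊ + 1)) : ℕ) : ℝ) ^ H * Real.exp (H - f₁ H n)
      ≤ (6 * Real.exp 1 * (8 * H + 3)) ^ H * (1 / (n * Real.log n ^ 2)) := by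
  have hn0 : (0 : ℝ) < n := by positivity
  have hn3 : (3 : ℝ) ≤ n := by exact_mod_cast hn
  set L := Real.log n with hL
  have hL1 : 1 ≤ L := by
    rw [hL, Real.le_log_iff_exp_le hn0]
    linarith [Real.exp_one_lt_d9]
  have hLL : Real.log L ≤ L := (Real.log_le_sub_one_of_pos (by linarith)).trans (by linarith)
  have hLL0 : 0 ≤ Real.log L := Real.log_nonneg hL1
  have h1 : (Nat.log 2 n : ℝ) + 1 ≤ 3 * L := by
    have h2 : (2 : ℝ) ^ Nat.log 2 n ≤ n := by exact_mod_cast Nat.pow_log_le_self 2 (by omega)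
    have h3 := Real.log_le_log (by positivity) h2
    rw [Real.log_pow] at h3
    have h4 := Real.log_two_gt_d9
    have h5 : (0 : ℝ) ≤ Nat.log 2 n := Nat.cast_nonneg _
    nlinarith
  have hf0 : 0 ≤ f₁ H n := by unfold f₁; positivity
  have h2 : (⌊2 * f₁ H n⌋₊ : ℝ) + 1 ≤ (8 * H + 3) * L := by
    have h3 := Nat.floor_le (by positivity : 0 ≤ 2 * f₁ H n)
    have h4 : f₁ H n ≤ L + 4 * H * L := by unfold f₁; gcongr
    nlinarith
  have h3 : ((2 * ((Nat.log 2 n + 1) * (⌊2 * f₁ H n⌋₊ + 1)) : ℕ) : ℝ)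
      ≤ 6 * (8 * H + 3) * L ^ 2 := by
    push_cast
    calc (2 : ℝ) * ((Nat.log 2 n + 1) * (⌊2 * f₁ H n⌋₊ + 1))
        ≤ 2 * ((3 * L) * ((8 * H + 3) * L)) := by gcongr
      _ = _ := by ring
  have h4 : Real.exp (H - f₁ H n) = Real.exp 1 ^ H * (1 / (n * L ^ (4 * H))) := by
    have e : (H : ℝ) - f₁ H n = H * 1 - (L + ((4 * H : ℕ) : ℝ) * Real.log L) := by
      unfold f₁; push_cast; ring
    rw [e, Real.exp_sub, Real.exp_add, Real.exp_nat_mul, Real.exp_nat_mul,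
      Real.exp_log hn0, Real.exp_log (show 0 < L by linarith)]
    ring
  rw [h4]
  have h5 : L ^ 2 ≤ L ^ (2 * H) := pow_le_pow_right₀ hL1 (by omega)
  calc _ ≤ (6 * (8 * H + 3) * L ^ 2) ^ H * (Real.exp 1 ^ H * (1 / (n * L ^ (4 * H)))) := by
        gcongr
    _ = (6 * Real.exp 1 * (8 * H + 3)) ^ H * (1 / (n * L ^ (2 * H))) := by
        have : L ^ (4 * H) = L ^ (2 * H) * L ^ (2 * H) := by rw [← pow_add]; congr 1; ring
        rw [this, mul_pow, mul_pow, mul_pow, mul_pow, ← pow_mul]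
        field_simp
    _ ≤ _ := by gcongr

/-- Comparison with the telescoping sum of `1 / log (n - 1) - 1 / log n`. -/
lemma sum_one_div_mul_log_sq_le (N : ℕ) :
    ∑ n ∈ Finset.Icc 3 N, 1 / ((n : ℝ) * Real.log n ^ 2) ≤ 1 / Real.log 2 := by
  have hl2 : 0 < Real.log 2 := Real.log_pos (by norm_num)
  rcases Nat.lt_or_ge N 2 with hN | hN
  · rw [Finset.Icc_eq_empty (by omega)]
    simp; positivity
  suffices h : ∑ n ∈ Finset.Icc 3 N, 1 / ((n : ℝ) * Real.log n ^ 2)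
      ≤ 1 / Real.log 2 - 1 / Real.log N by
    have : 0 < Real.log N := Real.log_pos (by exact_mod_cast hN)
    have : 0 < 1 / Real.log N := by positivity
    linarith
  induction N, hN using Nat.le_induction with
  | base => simp
  | succ N hN ih =>
    rw [Finset.sum_Icc_succ_top (by omega)]
    have hN0 : (0 : ℝ) < N := by positivity
    have hlN : 0 < Real.log N := Real.log_pos (by exact_mod_cast hN)
    have hle : Real.log N ≤ Real.log (N + 1 : ℕ) :=
      Real.log_le_log hN0 (by push_cast; linarith)
    have hlN1 : 0 < Real.log (N + 1 : ℕ) := hlN.trans_le hle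
    have hM0 : (0 : ℝ) < (N + 1 : ℕ) := by positivity
    set l := Real.log N
    set l' := Real.log (N + 1 : ℕ)
    have hdiff : 1 / ((N + 1 : ℕ) : ℝ) ≤ l' - l := by
      have h1 := Real.log_le_sub_one_of_pos (div_pos hN0 hM0)
      rw [Real.log_div hN0.ne' hM0.ne'] at h1
      have h2 : (N : ℝ) / (N + 1 : ℕ) - 1 = -(1 / ((N + 1 : ℕ) : ℝ)) := by
        push_cast; field_simp; ring
      linarith
    have : 1 / (((N + 1 : ℕ) : ℝ) * l' ^ 2) ≤ 1 / l - 1 / l' := by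
      calc 1 / (((N + 1 : ℕ) : ℝ) * l' ^ 2) = 1 / ((N + 1 : ℕ) : ℝ) / (l' * l') := by
            rw [div_div, sq]
        _ ≤ (l' - l) / (l * l') := by gcongr
        _ = 1 / l - 1 / l' := by field_simp
    linarith

lemma sum_exp_neg_mul_le {c : ℝ} (hc : 0 < c) (N : ℕ) :
    ∑ s ∈ Finset.Icc 1 N, Real.exp (-(c * s)) ≤ 1 / (c + c ^ 2 / 2) := by
  have hD : 0 < c + c ^ 2 / 2 := by positivity
  suffices h : ∑ s ∈ Finset.Icc 1 N, Real.exp (-(c * s))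
      ≤ (1 - Real.exp (-(c * N))) / (c + c ^ 2 / 2) by
    refine h.trans ?_
    gcongr
    linarith [Real.exp_pos (-(c * N))]
  induction N with
  | zero => simp
  | succ N ih =>
    rw [Finset.sum_Icc_succ_top (by omega)]
    have h1 := Real.quadratic_le_exp_of_nonneg hc.le
    have h2 : Real.exp (-(c * N)) = Real.exp (-(c * (N + 1 : ℕ))) * Real.exp c := by
      rw [← Real.exp_add]; congr 1; push_cast; ring
    have h3 := Real.exp_pos (-(c * (N + 1 : ℕ)))
    rw [le_div_iff₀ hD] at ih ⊢
    rw [add_mul]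
    rw [h2] at ih
    nlinarith

/-- A bound on the expected number of uses of a link with an inaccurate estimate; the first use, for
lack of any estimate, contributes one. -/
lemma one_add_sum_exp_le {ε θ : ℝ} (hε : 0 < ε) (hε1 : ε < 1) (hθ : 0 < θ) (hθ1 : θ ≤ 1) (N : ℕ) :
    1 + ∑ s ∈ Finset.Icc 1 N, (Real.exp (-(2 * (ε ^ 2 * θ) * s)) + Real.exp (-(ε ^ 2 * θ * s)))
      ≤ 2 * (ε ^ 2)⁻¹ * (θ ^ 2)⁻¹ := by
  set a := ε ^ 2 * θ with ha
  have ha0 : 0 < a := by positivity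
  have ha1 : a ≤ 1 := by
    have : ε ^ 2 ≤ 1 := by nlinarith
    nlinarith
  rw [Finset.sum_add_distrib]
  have h1 := sum_exp_neg_mul_le (c := 2 * a) (by positivity) N
  have h2 := sum_exp_neg_mul_le ha0 N
  have h3 : 1 + (1 / (2 * a + (2 * a) ^ 2 / 2) + 1 / (a + a ^ 2 / 2)) ≤ 2 / a := by
    have e : 2 / a - (1 + (1 / (2 * a + (2 * a) ^ 2 / 2) + 1 / (a + a ^ 2 / 2)))
        = (1 - a) * (2 + 5 * a + 2 * a ^ 2) / (2 * a * (1 + a) * (2 + a)) +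
          a ^ 2 / (2 * a * (1 + a) * (2 + a)) := by
      field_simp
      ring
    have : 0 ≤ (1 - a) * (2 + 5 * a + 2 * a ^ 2) / (2 * a * (1 + a) * (2 + a)) +
        a ^ 2 / (2 * a * (1 + a) * (2 + a)) :=
      add_nonneg (div_nonneg (mul_nonneg (by linarith) (by positivity)) (by positivity))
        (by positivity)
    linarith
  have h4 : 2 / a ≤ 2 * (ε ^ 2)⁻¹ * (θ ^ 2)⁻¹ := by
    have : θ ^ 2 ≤ θ := by nlinarith
    calc 2 / a = 2 * (ε ^ 2)⁻¹ * θ⁻¹ := by rw [ha]; field_simp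
      _ ≤ _ := by gcongr
  linarith

lemma f₁_le_f₁ {H m n : ℕ} (hm : 3 ≤ m) (hmn : m ≤ n) : f₁ H m ≤ f₁ H n := by
  have hm3 : (3 : ℝ) ≤ m := by exact_mod_cast hm
  have hle : (m : ℝ) ≤ n := by exact_mod_cast hmn
  have h1 : Real.log m ≤ Real.log n := Real.log_le_log (by linarith) hle
  have h0 : 0 < Real.log m := Real.log_pos (by linarith)
  unfold f₁
  have := Real.log_le_log h0 h1
  gcongr

lemma f₁_pos {H n : ℕ} (hn : 3 ≤ n) : 0 < f₁ H n := by
  have hn3 : (3 : ℝ) ≤ n := by exact_mod_cast hn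
  have h1 : 1 ≤ Real.log n := by
    rw [Real.le_log_iff_exp_le (by linarith)]
    linarith [Real.exp_one_lt_d9]
  have := Real.log_nonneg h1
  unfold f₁
  positivity

/-! ### The gaps of a network -/

namespace Network

lemma IsWalk.mem_map_tgt {V E : Type*} {G : Network V E} {u v : V} {l : List E} (h : G.IsWalk u l v)
    (hl : l ≠ []) : v ∈ l.map G.tgt := by
  induction l generalizing u with
  | nil => exact absurd rfl hl
  | cons e l ih =>
    obtain ⟨-, h⟩ := h
    rcases eq_or_ne l [] with rfl | hl'
    · have : G.tgt e = v := h
      simp [this]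
    · simpa using Or.inr (by simpa using ih h hl')

variable {V E : Type*} [Fintype E] {G : Network V E} {θ : E → ℝ}

lemma setOf_pathDelay_eq (G : Network V E) (θ : E → ℝ) :
    {x | ∃ p ∈ G.paths, x = pathDelay θ p} = pathDelay θ '' (G.paths : Set (Finset E)) := by
  ext x; simp [eq_comm]

lemma exists_pathDelay_eq_optDelay (h : G.paths.Nonempty) :
    ∃ p ∈ G.paths, pathDelay θ p = G.optDelay θ := by
  have hne : (pathDelay θ '' (G.paths : Set (Finset E))).Nonempty := by simpa using h
  have := hne.csInf_mem (G.paths.finite_toSet.image _)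
  rw [← setOf_pathDelay_eq] at this
  obtain ⟨p, hp, e⟩ := this
  exact ⟨p, hp, e.symm⟩

lemma gap_nonneg {p : Finset E} (hp : p ∈ G.paths) : 0 ≤ G.gap θ p := by
  rw [gap, sub_nonneg, optDelay, setOf_pathDelay_eq]
  exact csInf_le (G.paths.finite_toSet.image _).bddBelow ⟨p, hp, rfl⟩

lemma setOf_gap_eq (G : Network V E) (θ : E → ℝ) :
    {x | ∃ p ∈ G.paths, G.gap θ p ≠ 0 ∧ x = G.gap θ p}
      = G.gap θ '' {p | p ∈ G.paths ∧ G.gap θ p ≠ 0} := by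
  ext x; simp [eq_comm, and_assoc]

lemma finite_setOf_suboptimal (G : Network V E) (θ : E → ℝ) :
    {p | p ∈ G.paths ∧ G.gap θ p ≠ 0}.Finite :=
  G.paths.finite_toSet.subset fun _ h => h.1

lemma gapMin_le {p : Finset E} (hp : p ∈ G.paths) (h : G.gap θ p ≠ 0) :
    G.gapMin θ ≤ G.gap θ p := by
  rw [gapMin, setOf_gap_eq]
  exact csInf_le ((finite_setOf_suboptimal G θ).image _).bddBelow ⟨p, ⟨hp, h⟩, rfl⟩

lemma gapMin_pos (h : ∃ p ∈ G.paths, G.gap θ p ≠ 0) : 0 < G.gapMin θ := by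
  obtain ⟨p, hp, hg⟩ := h
  have hne : (G.gap θ '' {p | p ∈ G.paths ∧ G.gap θ p ≠ 0}).Nonempty := ⟨_, p, ⟨hp, hg⟩, rfl⟩
  have := hne.csInf_mem ((finite_setOf_suboptimal G θ).image _)
  obtain ⟨q, ⟨hq, hq0⟩, e⟩ := this
  rw [gapMin, setOf_gap_eq, ← e]
  exact lt_of_le_of_ne (gap_nonneg hq) hq0.symm

lemma card_le_maxLength {p : Finset E} (hp : p ∈ G.paths) : p.card ≤ G.maxLength :=
  Finset.le_sup (f := Finset.card) hp

/-- A suboptimal path exists only if source and destination differ, so that all paths have links. -/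
lemma optDelay_pos (hθ : ∀ i, 0 < θ i) (h : ∃ p ∈ G.paths, G.gap θ p ≠ 0) :
    0 < G.optDelay θ := by
  classical
  obtain ⟨p, hp, hg⟩ := h
  obtain ⟨q, hq, e⟩ := exists_pathDelay_eq_optDelay (θ := θ) ⟨p, hp⟩
  have hpath : ∀ r : Finset E, r ∈ G.paths → G.IsPath r := fun r hr => (Finset.mem_filter.1 hr).2
  rw [← e]
  refine Finset.sum_pos (fun i _ => inv_pos.2 (hθ i)) ?_
  by_contra hemp
  rw [Finset.not_nonempty_iff_eq_empty] at hemp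
  obtain ⟨l, hw, -, hl⟩ := hpath q hq
  have hl0 : l = [] := List.eq_nil_iff_forall_not_mem.2 fun a ha => by
    have := (hl a).2 ha
    simp [hemp] at this
  subst hl0
  have hsd : G.s = G.d := hw
  obtain ⟨l', hw', hnd, hl'⟩ := hpath p hp
  have hl'0 : l' = [] := by
    by_contra hne
    exact (List.nodup_cons.1 hnd).1 (hsd ▸ hw'.mem_map_tgt hne)
  have hp0 : p = ∅ := Finset.eq_empty_of_forall_notMem fun a ha => by
    have := (hl' a).1 ha
    simp [hl'0] at this
  apply hg
  rw [gap, ← e, hp0, hemp, sub_self]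

lemma thetaMin_le (θ : E → ℝ) (i : E) : thetaMin θ ≤ θ i :=
  ciInf_le (Set.finite_range θ).bddBelow i

lemma thetaMin_pos [Nonempty E] (hθ : ∀ i, 0 < θ i) : 0 < thetaMin θ := by
  obtain ⟨i, hi⟩ := exists_eq_ciInf_of_finite (f := θ)
  rw [thetaMin, ← hi]
  exact hθ i

lemma gap_le [Nonempty E] (hθ : ∀ i, 0 < θ i) {p : Finset E} (hp : p ∈ G.paths)
    (hD : 0 ≤ G.optDelay θ) : G.gap θ p ≤ G.maxLength * (thetaMin θ)⁻¹ := by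
  have hm := thetaMin_pos hθ
  calc G.gap θ p ≤ pathDelay θ p := by rw [gap]; linarith
    _ ≤ p.card • (thetaMin θ)⁻¹ :=
        Finset.sum_le_card_nsmul _ _ _ fun i _ => inv_anti₀ hm (thetaMin_le θ i)
    _ ≤ _ := by
        rw [nsmul_eq_mul]
        have : (p.card : ℝ) ≤ G.maxLength := by exact_mod_cast card_le_maxLength hp
        gcongr

end Network

/-! ### The regret bounds -/

open Classical in
/-- Pathwise accounting of the regret. A round costs at most `D` if it is one of the first two, if
the event `a` spoils it, or if it uses a link for the first time or with a count that `b` declares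
inaccurate; for each link and each count there is at most one such round. All other rounds satisfy
the assumption of `sum_le_of_sq_le_sum_inv`. -/
lemma sum_gap_le {E : Type*} [Fintype E] {P : ℕ → Finset E} {g : ℕ → ℝ} {H N : ℕ}
    {Φ m D : ℝ} {a : ℕ → Prop} {b : E → ℕ → Prop} (hΦ : 0 < Φ) (hm : 0 < m)
    (hg0 : ∀ n, 0 ≤ g n) (hgm : ∀ n, g n ≠ 0 → m ≤ g n) (hgD : ∀ n, g n ≤ D)
    (hH : ∀ n, (P n).card ≤ H)
    (hgood : ∀ n, 3 ≤ n → n ≤ N → ¬ a n →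
      (∀ i ∈ P n, 1 ≤ useCount P n i ∧ ¬ b i (useCount P n i)) → g n ≠ 0 →
      g n ^ 2 ≤ Φ * ∑ i ∈ P n, 1 / (useCount P n i : ℝ)) :
    ∑ n ∈ Finset.Icc 1 N, g n ≤
      D * (2 + ((Finset.Icc 3 N).filter a).card +
        ∑ i, (1 + (((Finset.Icc 1 N).filter (b i)).card : ℝ))) +
      8 * Φ * Fintype.card E * √H / m := by
  have hD : 0 ≤ D := (hg0 0).trans (hgD 0)
  set C : ℕ → Prop := fun n =>
    3 ≤ n ∧ ¬ a n ∧ ∀ i ∈ P n, 1 ≤ useCount P n i ∧ ¬ b i (useCount P n i) with hC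
  rw [← Finset.sum_filter_add_sum_filter_not (Finset.Icc 1 N) C, add_comm]
  refine add_le_add ?_ ?_
  · have hsub : (Finset.Icc 1 N).filter (fun n => ¬ C n) ⊆
        ({1, 2} ∪ (Finset.Icc 3 N).filter a) ∪ Finset.univ.biUnion fun i : E =>
          (Finset.Icc 1 N).filter fun n => i ∈ P n ∧
            useCount P n i ∈ insert 0 ((Finset.Icc 1 N).filter (b i)) := by
      intro n hn
      obtain ⟨hnN, hnC⟩ := Finset.mem_filter.1 hn
      obtain ⟨h1, h2⟩ := Finset.mem_Icc.1 hnN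
      simp only [Finset.mem_union, Finset.mem_insert, Finset.mem_singleton, Finset.mem_filter,
        Finset.mem_Icc, Finset.mem_biUnion, Finset.mem_univ, true_and]
      by_contra hcon
      push Not at hcon
      obtain ⟨⟨⟨hn1, hn2⟩, hna⟩, hb⟩ := hcon
      refine hnC ⟨by omega, hna ⟨by omega, h2⟩, fun i hi => ?_⟩
      obtain ⟨h3, h4⟩ := hb i ⟨h1, h2⟩ hi
      have h5 := useCount_lt_self P h1 i
      exact ⟨by omega, h4 ⟨by omega, by omega⟩⟩
    have hcard : (((Finset.Icc 1 N).filter fun n => ¬ C n).card : ℝ) ≤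
        2 + ((Finset.Icc 3 N).filter a).card +
          ∑ i, (1 + (((Finset.Icc 1 N).filter (b i)).card : ℝ)) := by
      have h1 : ((Finset.Icc 1 N).filter fun n => ¬ C n).card ≤
          2 + ((Finset.Icc 3 N).filter a).card +
            ∑ i, (1 + ((Finset.Icc 1 N).filter (b i)).card) := by
        refine (Finset.card_le_card hsub).trans ((Finset.card_union_le _ _).trans
          (add_le_add ((Finset.card_union_le _ _).trans (add_le_add (Finset.card_le_two) le_rfl))
            (Finset.card_biUnion_le.trans (Finset.sum_le_sum fun i _ => ?_))))
        refine (Finset.card_le_card_of_injOn (fun n => useCount P n i) ?_ ?_).trans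
          ((Finset.card_insert_le 0 ((Finset.Icc 1 N).filter (b i))).trans (add_comm _ _).le)
        · intro n hn
          exact (Finset.mem_filter.1 hn).2.2
        · refine (useCount_injOn P i).mono fun n hn => ?_
          have := Finset.mem_filter.1 hn
          exact ⟨(Finset.mem_Icc.1 this.1).1, this.2.1⟩
      exact_mod_cast h1
    calc _ ≤ (((Finset.Icc 1 N).filter fun n => ¬ C n).card : ℝ) * D := by
          rw [← nsmul_eq_mul]
          exact Finset.sum_le_card_nsmul _ _ _ fun n _ => hgD n
      _ ≤ _ := by rw [mul_comm]; gcongr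
  · rw [← Finset.sum_filter_ne_zero]
    refine sum_le_of_sq_le_sum_inv (P := P) ?_ hΦ hm ?_ (fun n _ => hH n) ?_ ?_
    · intro n hn
      simp only [Finset.mem_filter, Finset.mem_Icc] at hn
      exact hn.1.1.1
    · intro n hn
      exact hgm n (Finset.mem_filter.1 hn).2
    · intro n hn i hi
      simp only [Finset.mem_filter] at hn
      exact (hn.1.2.2.2 i hi).1
    · intro n hn
      simp only [Finset.mem_filter, Finset.mem_Icc] at hn
      exact hgood n hn.1.2.1 hn.1.1.2 hn.1.2.2.1 hn.1.2.2.2 hn.2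

/-- The constant `K'_H`: a bound on the expected number of rounds that are among the first two or at
which the true parameter is not feasible for a given optimal path. -/
noncomputable def infeasibleConst (H : ℕ) : ℝ :=
  2 + (6 * Real.exp 1 * (8 * H + 3)) ^ H / Real.log 2

lemma infeasibleConst_nonneg (H : ℕ) : 0 ≤ infeasibleConst H := by
  have : 0 < Real.log 2 := Real.log_pos (by norm_num)
  unfold infeasibleConst
  positivity

namespace RoutingProcess

variable {V E : Type*} [Fintype E] {G : Network V E} {θ : E → ℝ}
  {Ω : Type*} [MeasurableSpace Ω] {μ : Measure Ω}

/-- When the true parameter is feasible for an optimal path `q`, the index `c` of the chosen path is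
at most the optimal delay, under both policies. -/
lemma cIndex_path_le {R : RoutingProcess G θ μ} {ω : Ω} {n : ℕ} {q : Finset E}
    (hθ : ∀ i, 0 < θ i ∧ θ i ≤ 1)
    (hd : ∀ n, 1 ≤ n → ∀ i, 1 ≤ R.delay n i ω ∧ (θ i = 1 → R.delay n i ω = 1))
    (hR : R.b n ω (R.path n ω) ≤ R.b n ω q ∨ R.c n ω (R.path n ω) ≤ R.c n ω q)
    (hf : ((∑ i ∈ q, (R.attempts n ω i : ENNReal) *
        bernoulliKL (R.empirical n ω i) (θ i) : ENNReal) : EReal) ≤ (f₁ G.maxLength n : ℝ)) :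
    R.c n ω (R.path n ω) ≤ (Network.pathDelay θ q : ℝ) := by
  have hcb : ∀ p, R.c n ω p ≤ R.b n ω p := fun p =>
    cIndex_le_bIndex _ _ (fun i _ => packets_le_attempts hd n i)
      fun i _ hi => empirical_eq_div hd hi
  have hb : R.b n ω q ≤ (Network.pathDelay θ q : ℝ) := bIndex_le_pathDelay hθ hf
  rcases hR with h | h
  · exact (hcb _).trans (h.trans hb)
  · exact h.trans ((hcb q).trans hb)

/-- The finite-time regret bound. The exceptional events are replaced by measurable supersets, so
that their probabilities can be integrated. -/
theorem regret_le [IsProbabilityMeasure μ] (R : RoutingProcess G θ μ)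
    (hθ : ∀ i, 0 < θ i ∧ θ i ≤ 1) (hsub : ∃ p ∈ G.paths, G.gap θ p ≠ 0)
    (hR : R.IsGeoCombUCB1 ∨ R.IsGeoCombUCB2) {ε : ℝ} (hε : 0 < ε) (hε1 : ε < 1)
    (hεD : ε < G.gapMin θ / G.optDelay θ) {N : ℕ} (hN : 3 ≤ N) :
    R.regret N ≤ 4 * M G θ ε * Fintype.card E * √(G.maxLength : ℝ) * f₁ G.maxLength N /
        (G.gapMin θ * Network.thetaMin θ ^ 3) +
      G.maxLength * (Network.thetaMin θ)⁻¹ *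
        (infeasibleConst G.maxLength + 2 * (ε ^ 2)⁻¹ * ∑ i, ((θ i) ^ 2)⁻¹) := by
  classical
  have hθ0 : ∀ i, 0 < θ i := fun i => (hθ i).1
  have hδ := Network.gapMin_pos hsub
  have hD := Network.optDelay_pos hθ0 hsub
  obtain ⟨p, hp, hpg⟩ := hsub
  obtain ⟨q, hq, hqD⟩ := Network.exists_pathDelay_eq_optDelay (θ := θ) ⟨p, hp⟩
  have hq0 : q.Nonempty := by
    by_contra h
    rw [Finset.not_nonempty_iff_eq_empty] at h
    rw [← hqD, h, Network.pathDelay, Finset.sum_empty] at hD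
    exact hD.false
  have : Nonempty E := ⟨hq0.choose⟩
  have hm := Network.thetaMin_pos hθ0
  set H := G.maxLength with hH
  have hH1 : 1 ≤ H := (Finset.card_pos.2 hq0).trans_le (Network.card_le_maxLength hq)
  have hεδ : ε * G.optDelay θ < G.gapMin θ := (lt_div_iff₀ hD).1 hεD
  have hM : 0 < M G θ ε := by
    have h1 : 0 < 1 - ε * G.optDelay θ / G.gapMin θ := by
      rw [sub_pos, div_lt_one hδ]; exact hεδ
    have h2 : 0 < 1 - ε := by linarith
    unfold M
    positivity
  set Φ := M G θ ε * f₁ H N / (2 * Network.thetaMin θ ^ 3) with hΦ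
  have hΦ0 : 0 < Φ := by have := f₁_pos (H := H) hN; positivity
  -- the exceptional events
  have hA : ∀ n : ℕ, ∃ A : Set Ω, MeasurableSet A ∧ (3 ≤ n →
      μ.real A ≤ (6 * Real.exp 1 * (8 * H + 3)) ^ H * (1 / (n * Real.log n ^ 2))) ∧
      ∀ᵐ ω ∂μ, 3 ≤ n → ω ∉ A → ((∑ i ∈ q, (R.attempts n ω i : ENNReal) *
        bernoulliKL (R.empirical n ω i) (θ i) : ENNReal) : EReal) ≤ (f₁ H n : ℝ) := by
    intro n
    by_cases hn : 3 ≤ n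
    · obtain ⟨A, h1, h2, h3⟩ := R.exists_feasible_event hθ (Network.card_le_maxLength hq)
        (by omega : 1 ≤ n) (f₁_pos (H := H) hn).le
      refine ⟨A, h1, fun _ => h2.trans (feasible_bound_le hH1 hn), ?_⟩
      filter_upwards [h3] with ω h _ using h
    · exact ⟨∅, MeasurableSet.empty, fun h => absurd h hn,
        Filter.Eventually.of_forall fun _ h => absurd h hn⟩
  choose A hAm hAμ hAω using hA
  have hB : ∀ (i : E) (s : ℕ), ∃ B : Set Ω, MeasurableSet B ∧ (1 ≤ s →
      μ.real B ≤ Real.exp (-(2 * (ε ^ 2 * θ i) * s)) + Real.exp (-(ε ^ 2 * θ i * s))) ∧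
      ∀ᵐ ω ∂μ, 1 ≤ s → ω ∉ B → ∀ n ≤ N, R.packets n ω i = s →
        (1 - ε) * θ i ≤ R.empirical n ω i ∧ R.empirical n ω i ≤ (1 + ε) * θ i := by
    intro i s
    by_cases hs : 1 ≤ s
    · obtain ⟨B, h1, h2, h3⟩ := R.exists_accurate_event hθ i hε hε1 hs N
      refine ⟨B, h1, fun _ => h2, ?_⟩
      filter_upwards [h3] with ω h _ using h
    · exact ⟨∅, MeasurableSet.empty, fun h => absurd h hs,
        Filter.Eventually.of_forall fun _ h => absurd h hs⟩
  choose B hBm hBμ hBω using hB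
  have hpol : ∀ᵐ ω ∂μ, ∀ n, 3 ≤ n →
      (R.b n ω (R.path n ω) ≤ R.b n ω q ∨ R.c n ω (R.path n ω) ≤ R.c n ω q) := by
    rcases hR with h | h
    · filter_upwards [ae_all_iff.2 fun n => ae_all_iff.2 (h n)] with ω hω n hn
      exact Or.inl (hω n hn q hq)
    · filter_upwards [ae_all_iff.2 fun n => ae_all_iff.2 (h n)] with ω hω n hn
      exact Or.inr (hω n hn q hq)
  set D := (H : ℝ) * (Network.thetaMin θ)⁻¹ with hDdef
  have hD0 : 0 ≤ D := by positivity
  set c := 8 * Φ * Fintype.card E * √(H : ℝ) / G.gapMin θ with hc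
  have hind : ∀ (S : Set Ω) (ω : Ω), (if ω ∈ S then (1 : ℝ) else 0) = S.indicator 1 ω :=
    fun S ω => by simp [Set.indicator_apply]
  have hpt : ∀ᵐ ω ∂μ, ∑ n ∈ Finset.Icc 1 N, G.gap θ (R.path n ω) ≤
      D * (2 + ∑ n ∈ Finset.Icc 3 N, (A n).indicator 1 ω +
        ∑ i, (1 + ∑ s ∈ Finset.Icc 1 N, (B i s).indicator 1 ω)) + c := by
    filter_upwards [R.ae_one_le_delay hθ, hpol, ae_all_iff.2 hAω,
      ae_all_iff.2 fun i => ae_all_iff.2 (hBω i)] with ω hd hpolω hAω hBω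
    have key := sum_gap_le (P := fun k => R.path k ω) (g := fun n => G.gap θ (R.path n ω))
      (N := N) (H := H) (Φ := Φ) (m := G.gapMin θ) (D := D) (a := fun n => ω ∈ A n)
      (b := fun i s => ω ∈ B i s) hΦ0 hδ
      (fun n => Network.gap_nonneg (R.path_mem n ω))
      (fun n h => Network.gapMin_le (R.path_mem n ω) h)
      (fun n => Network.gap_le hθ0 (R.path_mem n ω) hD.le)
      (fun n => Network.card_le_maxLength (R.path_mem n ω))
      (fun n hn hnN hnA hgood hg => by
        have hacc : ∀ i ∈ R.path n ω, (1 - ε) * θ i ≤ R.empirical n ω i ∧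
            R.empirical n ω i ≤ (1 + ε) * θ i := fun i hi =>
          hBω i (R.packets n ω i) (hgood i hi).1 (hgood i hi).2 n hnN rfl
        have hci := cIndex_path_le hθ hd (hpolω n hn) (hAω n hn hnA)
        rw [hqD] at hci
        exact sq_le_of_cIndex_le (s := R.packets n ω) (lam := R.empirical n ω) hδ hε hε1 hm
          (fun i _ => Network.thetaMin_le θ i) (fun i hi => (hgood i hi).1)
          (fun i hi => (hacc i hi).1) (fun i hi => (hacc i hi).2) hci
          (f₁_le_f₁ hn hnN) hD.le (Network.gapMin_le (R.path_mem n ω) hg) hεδ)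
    simp only [Finset.card_filter, Nat.cast_sum, Nat.cast_ite, Nat.cast_one, Nat.cast_zero,
      hind] at key
    exact key
  have hiA : ∀ n, Integrable ((A n).indicator (1 : Ω → ℝ)) μ := fun n =>
    (integrable_const (1 : ℝ)).indicator (hAm n)
  have hiB : ∀ i s, Integrable ((B i s).indicator (1 : Ω → ℝ)) μ := fun i s =>
    (integrable_const (1 : ℝ)).indicator (hBm i s)
  have hi1 : Integrable (fun ω => ∑ n ∈ Finset.Icc 3 N, (A n).indicator (1 : Ω → ℝ) ω) μ :=
    integrable_finsetSum _ fun n _ => hiA n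
  have hi2 : ∀ i, Integrable (fun ω => ∑ s ∈ Finset.Icc 1 N, (B i s).indicator (1 : Ω → ℝ) ω) μ :=
    fun i => integrable_finsetSum _ fun s _ => hiB i s
  have hi2' : ∀ i, Integrable (fun ω => 1 + ∑ s ∈ Finset.Icc 1 N,
      (B i s).indicator (1 : Ω → ℝ) ω) μ :=
    fun i => (integrable_const _).add (hi2 i)
  have hi3 : Integrable (fun ω => ∑ i, (1 + ∑ s ∈ Finset.Icc 1 N,
      (B i s).indicator (1 : Ω → ℝ) ω)) μ :=
    integrable_finsetSum _ fun i _ => hi2' i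
  have hi4 : Integrable (fun ω => 2 + ∑ n ∈ Finset.Icc 3 N, (A n).indicator (1 : Ω → ℝ) ω) μ :=
    (integrable_const _).add hi1
  have hi5 : Integrable (fun ω => D * (2 + ∑ n ∈ Finset.Icc 3 N, (A n).indicator (1 : Ω → ℝ) ω +
      ∑ i, (1 + ∑ s ∈ Finset.Icc 1 N, (B i s).indicator (1 : Ω → ℝ) ω))) μ :=
    (hi4.add hi3).const_mul D
  have hint : ∫ ω, (D * (2 + ∑ n ∈ Finset.Icc 3 N, (A n).indicator 1 ω +
        ∑ i, (1 + ∑ s ∈ Finset.Icc 1 N, (B i s).indicator 1 ω)) + c) ∂μ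
      = D * (2 + ∑ n ∈ Finset.Icc 3 N, μ.real (A n) +
        ∑ i, (1 + ∑ s ∈ Finset.Icc 1 N, μ.real (B i s))) + c := by
    rw [integral_add hi5 (integrable_const _), integral_const_mul,
      integral_add hi4 hi3, integral_add (integrable_const _) hi1,
      integral_finsetSum _ fun n _ => hiA n,
      integral_finsetSum _ fun i _ => hi2' i]
    simp only [integral_const, probReal_univ, one_smul, integral_indicator_one (hAm _)]
    congr 4
    funext i
    rw [integral_add (integrable_const _) (hi2 i), integral_finsetSum _ fun s _ => hiB i s]
    simp only [integral_const, probReal_univ, one_smul, integral_indicator_one (hBm _ _)]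
  have hgapint : Integrable (fun ω => ∑ n ∈ Finset.Icc 1 N, G.gap θ (R.path n ω)) μ :=
    integrable_finsetSum _ fun n hn => by
      obtain ⟨k, rfl⟩ := Nat.exists_eq_add_of_le' (Finset.mem_Icc.1 hn).1
      exact (R.integrable_comp_path k _).1
  have hSA : ∑ n ∈ Finset.Icc 3 N, μ.real (A n)
      ≤ (6 * Real.exp 1 * (8 * H + 3)) ^ H / Real.log 2 := by
    calc _ ≤ ∑ n ∈ Finset.Icc 3 N,
          (6 * Real.exp 1 * (8 * H + 3)) ^ H * (1 / ((n : ℝ) * Real.log n ^ 2)) :=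
          Finset.sum_le_sum fun n hn => hAμ n (Finset.mem_Icc.1 hn).1
      _ ≤ (6 * Real.exp 1 * (8 * H + 3)) ^ H * (1 / Real.log 2) := by
          rw [← Finset.mul_sum]
          gcongr
          exact sum_one_div_mul_log_sq_le N
      _ = _ := by ring
  have hSB : ∑ i, (1 + ∑ s ∈ Finset.Icc 1 N, μ.real (B i s))
      ≤ 2 * (ε ^ 2)⁻¹ * ∑ i, ((θ i) ^ 2)⁻¹ := by
    rw [Finset.mul_sum]
    refine Finset.sum_le_sum fun i _ =>
      le_trans ?_ (one_add_sum_exp_le hε hε1 (hθ i).1 (hθ i).2 N)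
    gcongr with s hs
    exact hBμ i s (Finset.mem_Icc.1 hs).1
  rw [R.regret_eq_integral_gap hθ]
  calc _ ≤ ∫ ω, (D * (2 + ∑ n ∈ Finset.Icc 3 N, (A n).indicator 1 ω +
        ∑ i, (1 + ∑ s ∈ Finset.Icc 1 N, (B i s).indicator 1 ω)) + c) ∂μ :=
        integral_mono_ae hgapint (hi5.add (integrable_const _)) hpt
    _ = _ := hint
    _ ≤ D * (infeasibleConst H + 2 * (ε ^ 2)⁻¹ * ∑ i, ((θ i) ^ 2)⁻¹) + c := by
        gcongr
        unfold infeasibleConst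
        linarith
    _ = _ := by
        rw [hc, hΦ]
        field_simp
        ring

lemma regret_nonneg [IsProbabilityMeasure μ] (R : RoutingProcess G θ μ)
    (hθ : ∀ i, 0 < θ i ∧ θ i ≤ 1) (N : ℕ) : 0 ≤ R.regret N := by
  rw [R.regret_eq_integral_gap hθ]
  exact integral_nonneg fun ω => Finset.sum_nonneg fun n _ => Network.gap_nonneg (R.path_mem n ω)

/-- The logarithmic regret bound, from `regret_le` at a fixed accuracy `ε` for which `M ≤ 2`, once
`N` is so large that `4 H log log N ≤ log N` and the constant term is dominated by `log N`. -/
theorem isBigOWith_regret [IsProbabilityMeasure μ] (R : RoutingProcess G θ μ)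
    (hθ : ∀ i, 0 < θ i ∧ θ i ≤ 1) (hsub : ∃ p ∈ G.paths, G.gap θ p ≠ 0)
    (hR : R.IsGeoCombUCB1 ∨ R.IsGeoCombUCB2) :
    Asymptotics.IsBigOWith (17 / (G.gapMin θ * Network.thetaMin θ ^ 3)) Filter.atTop
      (fun N : ℕ => R.regret N)
      (fun N : ℕ => (Fintype.card E : ℝ) * √(G.maxLength : ℝ) * Real.log N) := by
  have hθ0 : ∀ i, 0 < θ i := fun i => (hθ i).1
  have hδ := Network.gapMin_pos hsub
  have hD := Network.optDelay_pos hθ0 hsub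
  obtain ⟨q, hq, hqD⟩ := Network.exists_pathDelay_eq_optDelay (θ := θ)
    (hsub.imp fun _ h => h.1)
  have hq0 : q.Nonempty := by
    by_contra h
    rw [Finset.not_nonempty_iff_eq_empty] at h
    rw [← hqD, h, Network.pathDelay, Finset.sum_empty] at hD
    exact hD.false
  have : Nonempty E := ⟨hq0.choose⟩
  have hm := Network.thetaMin_pos hθ0
  have hH1 : 1 ≤ G.maxLength := (Finset.card_pos.2 hq0).trans_le (Network.card_le_maxLength hq)
  have hH0 : (0 : ℝ) < G.maxLength := by exact_mod_cast hH1
  have hE0 : (0 : ℝ) < Fintype.card E := by exact_mod_cast Fintype.card_pos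
  -- a fixed accuracy for which `M ≤ 2`
  set ε := min (1 / 20) (G.gapMin θ / G.optDelay θ / 20) with hε
  have hε0 : 0 < ε := by positivity
  have hε20 : ε ≤ 1 / 20 := min_le_left _ _
  have hεD : ε ≤ G.gapMin θ / G.optDelay θ / 20 := min_le_right _ _
  have hx : ε * G.optDelay θ / G.gapMin θ ≤ 1 / 20 := by
    rw [div_le_iff₀ hδ]
    have := mul_le_mul_of_nonneg_right hεD hD.le
    have e : G.gapMin θ / G.optDelay θ / 20 * G.optDelay θ = 1 / 20 * G.gapMin θ := by field_simp
    linarith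
  have hM2 : M G θ ε ≤ 2 := by
    unfold M
    have h1 : (1 + ε) ^ 2 ≤ (21 / 20) ^ 2 := by gcongr; linarith
    have h2 : (19 / 20 : ℝ) ^ 3 * (19 / 20) ^ 2
        ≤ (1 - ε) ^ 3 * (1 - ε * G.optDelay θ / G.gapMin θ) ^ 2 := by
      have h3 : 0 ≤ 1 - ε := by linarith
      exact mul_le_mul (pow_le_pow_left₀ (by norm_num) (by linarith) 3)
        (pow_le_pow_left₀ (by norm_num) (by linarith) 2) (by positivity) (by positivity)
    rw [div_le_iff₀ (lt_of_lt_of_le (by norm_num) h2)]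
    calc _ ≤ (21 / 20 : ℝ) ^ 2 := h1
      _ ≤ 2 * ((19 / 20 : ℝ) ^ 3 * (19 / 20) ^ 2) := by norm_num
      _ ≤ _ := by gcongr
  set W := Fintype.card E * √(G.maxLength : ℝ) / (G.gapMin θ * Network.thetaMin θ ^ 3) with hW
  have hW0 : 0 < W := by positivity
  set c := G.maxLength * (Network.thetaMin θ)⁻¹ *
    (infeasibleConst G.maxLength + 2 * (ε ^ 2)⁻¹ * ∑ i, ((θ i) ^ 2)⁻¹) with hc
  have hlog : Filter.Tendsto (fun N : ℕ => Real.log N) Filter.atTop Filter.atTop :=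
    Real.tendsto_log_atTop.comp tendsto_natCast_atTop_atTop
  have hll := hlog.eventually
    (Real.isLittleO_log_id_atTop.bound (c := 1 / (4 * (G.maxLength : ℝ))) (by positivity))
  rw [Asymptotics.isBigOWith_iff]
  filter_upwards [Filter.eventually_ge_atTop 3, hll, hlog.eventually_ge_atTop (c / W)]
    with N hN hllN hcN
  have hl1 : 1 ≤ Real.log N := by
    have hN3 : (3 : ℝ) ≤ N := by exact_mod_cast hN
    rw [Real.le_log_iff_exp_le (by linarith)]
    linarith [Real.exp_one_lt_d9]
  have hratio : 0 < G.gapMin θ / G.optDelay θ := by positivity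
  have h1 := R.regret_le hθ hsub hR hε0 (by linarith) (by linarith) hN
  have hf : f₁ G.maxLength N ≤ 2 * Real.log N := by
    simp only [id, Real.norm_eq_abs] at hllN
    rw [abs_of_nonneg (Real.log_nonneg hl1), abs_of_nonneg (by linarith), div_mul_eq_mul_div,
      one_mul, le_div_iff₀ (by positivity)] at hllN
    unfold f₁
    linarith
  have hf0 := f₁_pos (H := G.maxLength) hN
  rw [Real.norm_of_nonneg (R.regret_nonneg hθ N), Real.norm_of_nonneg (by positivity)]
  have h2 : 4 * M G θ ε * Fintype.card E * √(G.maxLength : ℝ) * f₁ G.maxLength N /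
      (G.gapMin θ * Network.thetaMin θ ^ 3) = W * (4 * M G θ ε * f₁ G.maxLength N) := by
    rw [hW]; ring
  have h3 : W * (4 * M G θ ε * f₁ G.maxLength N) ≤ W * (4 * 2 * (2 * Real.log N)) := by
    gcongr
  have h4 : c ≤ W * Real.log N := by
    rw [div_le_iff₀ hW0] at hcN; linarith
  calc R.regret N ≤ W * (4 * 2 * (2 * Real.log N)) + W * Real.log N := by
        rw [h2] at h1; linarith
    _ = _ := by rw [hW]; ring

end RoutingProcess
end ShortestPath

theorem theorem5 :
    ∃ (K : ℕ → ℝ) (C : ℝ), (∀ H, 0 ≤ K H) ∧ 0 < C ∧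
      ∀ (V E : Type*) [Fintype E] (G : ShortestPath.Network V E) (θ : E → ℝ)
        (_ : ∀ i, 0 < θ i ∧ θ i ≤ 1) (_ : ∃ p ∈ G.paths, G.gap θ p ≠ 0)
        (Ω : Type*) [MeasurableSpace Ω] (μ : MeasureTheory.Measure Ω)
        [MeasureTheory.IsProbabilityMeasure μ] (R : ShortestPath.RoutingProcess G θ μ)
        (_ : R.IsGeoCombUCB1 ∨ R.IsGeoCombUCB2),
        (∀ n, 1 ≤ n → MeasureTheory.Integrable (R.totalDelay n) μ) ∧
        (∀ ε : ℝ, 0 < ε → ε < 1 → ε < G.gapMin θ / G.optDelay θ → ∀ N : ℕ, 3 ≤ N →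
          R.regret N ≤
            4 * ShortestPath.M G θ ε * Fintype.card E * √(G.maxLength : ℝ) *
                (Real.log N + 4 * G.maxLength * Real.log (Real.log N)) /
              (G.gapMin θ * ShortestPath.Network.thetaMin θ ^ 3) +
            G.maxLength * (ShortestPath.Network.thetaMin θ)⁻¹ *
              (K G.maxLength + 2 * (ε ^ 2)⁻¹ * ∑ i, ((θ i) ^ 2)⁻¹)) ∧
        Asymptotics.IsBigOWith (C / (G.gapMin θ * ShortestPath.Network.thetaMin θ ^ 3))
          Filter.atTop (fun N : ℕ => R.regret N)
          (fun N : ℕ => (Fintype.card E : ℝ) * √(G.maxLength : ℝ) * Real.log N) := by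
  refine ⟨ShortestPath.infeasibleConst, 17, ShortestPath.infeasibleConst_nonneg, by norm_num, ?_⟩
  intro V E _ G θ hθ hsub Ω _ μ _ R hR
  refine ⟨fun n hn => ?_, fun ε hε hε1 hεD N hN => R.regret_le hθ hsub hR hε hε1 hεD hN,
    R.isBigOWith_regret hθ hsub hR⟩
  obtain ⟨m, rfl⟩ := Nat.exists_eq_add_of_le' hn
  exact R.integrable_totalDelay hθ m
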